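/- **Setting.** Let $K$ be a field of characteristic $0$, complete with respect to a nonarchimedean norm $|\cdot|$ with $|p|=p^{-1}$ for a prime $p$, let $n\ge 1$ and $\rho\in\mathbb R_{>0}^n$. Let $\Gamma_k$ be the group of $p^k$-th roots of unity in a fixed algebraic closure of $K$, $\Gamma=\bigcup_k\Gamma_k$, and give $K(\Gamma)$ the unique norm extending that of $K$. For a closed polysegment $J=\prod_i[\alpha_i,\beta_i]$ with $0<\alpha_i<\rho_i<\beta_i$ (a closed polysegment containing $\rho$ in its interior) let $K_{J,n}$ be the ring of Laurent series $f=\sum_{i\in\mathbb Z^n}f_it^i$ over $K$ with $|f_i|\sigma^i\to0$ as $|i|\to\infty$ for every $\sigma\in J$, put $|f|_\sigma=\max_i|f_i|\sigma^i$ and $|f|_J=\max_{\sigma\in J}|f|_\sigma$, and use the same notation on $K_{J,n}\otimes_KK(\Gamma)$ and, taking the maximum over the entries, for matrices. Let $R_\rho=\varinjlim_JK_{J,n}$. The group $\Gamma^n$ acts $K(\Gamma)$-linearly on $K_{J,n}\otimes_KK(\Gamma)$ and on $R_\rho\otimes_KK(\Gamma)$ by $\zeta^*f(t)=f(\zeta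 t)$. **The category $\mathscr C_\rho$.** An object of $\mathscr C_\rho$ is a finite free $R_\rho$-module $P$ with a semilinear group action of $\Gamma^n$ on $P\otimes_KK(\Gamma)$ such that $\tau(\zeta^*x)=\tau(\zeta)^*(\tau x)$ for all $\tau\in\mathrm{Gal}(K(\Gamma)/K)$, $\zeta\in\Gamma^n$, $x\in P\otimes_KK(\Gamma)$, and such that $P$ is *defined by* some $P'$ over some $J$ as above. The latter means: $P'$ is a finite free $K_{J,n}$-module with a semilinear action of $\Gamma^n$ on $P'\otimes_KK(\Gamma)$; $P\cong R_\rho\otimes_{K_{J,n}}P'$, and the action on $P\otimes_KK(\Gamma)$ is induced from that on $P'\otimes_KK(\Gamma)$; and for some basis of $P'$ there is $l>0$ such that the matrix $E(\zeta)$ of $\zeta^*$ satisfies $|E(\zeta)|_J\le p^{lk}$ for all $k\ge1$ and $\zeta\in\Gamma_k^n$. **Exponents.** Let $P$ be an object of $\mathscr C_\rho$ of rank $m$ defined by $P'$ over $J$, and let $e_1,\dots,e_m$ be a basis of $P'$. A multiset $A=(A_1,\dots,A_m)$ in $\mathbb Z_p^n$ is an *exponent of $P$ defined by $P'$* if there are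 $m\times m$ matrices $S_k$ ($k\ge1$) over $K_{J,n}$ such that: (1) if $(v_{k,1},\dots,v_{k,m})=(e_1,\dots,e_m)S_k$, then $\zeta^*(v_{k,j})=\zeta^{A_j}v_{k,j}$ for all $j$ and all $\zeta\in\Gamma_k^n$; (2) there is $l>0$ with $|S_k|_J\le p^{lk}$ for all $k$; (3) $|\det S_k|_\sigma\ge1$ for all $k$ and all $\sigma\in J$. (This does not depend on the basis.) $A$ is an *exponent of $P$* if it is an exponent of $P$ defined by some $P'$ over some closed polysegment containing $\rho$ in its interior. **Weak equivalence.** For $x\in\mathbb Q_p$ let $\langle x\rangle$ be the smallest nonnegative $a\in\mathbb Z[1/p]$ such that $x-a$ or $x+a$ lies in $\mathbb Z_p$. Multisets $A=(A_1,\dots,A_m)$ and $B=(B_1,\dots,B_m)$ in $\mathbb Z_p^n$ are *weakly equivalent* if there are $c>0$ and permutations $\sigma_h$ ($h\ge1$) of $\{1,\dots,m\}$ with $$p^h\left\langle \frac{A^i_{\sigma_h(j)}-B^i_j}{p^h}\right\rangle\le ch\qquad(h\ge1,\ 1\le i\le n,\ 1\le j\le m),$$ where $A^i_j$ denotes the $i$-th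 entry of $A_j$. **Theorem.** Let $P$ be an object of $\mathscr C_\rho$ that is defined by $P_1$ over $J_1$ and by $P_2$ over $J_2$, where $J_1,J_2$ are closed polysegments containing $\rho$ in their interiors. Then every exponent of $P$ defined by $P_1$ is weakly equivalent to every exponent of $P$ defined by $P_2$. In particular, any two exponents of $P$ are weakly equivalent. -/

import Mathlib

universe u v w w₁ w₂

noncomputable section

namespace PFuchs

open Filter Topology TensorProduct

/-- The space `ℝ_{>0}^n` of multiradii. -/
abbrev Radius (n : ℕ) : Type := Fin n → {x : ℝ // 0 < x}

/-- The monomial `σ^i = σ₁^{i₁} ⋯ σₙ^{iₙ}`. -/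
def Radius.mono {n : ℕ} (σ : Radius n) (i : Fin n → ℤ) : ℝ := ∏ r, (σ r : ℝ) ^ i r

theorem Radius.mono_pos {n : ℕ} (σ : Radius n) (i : Fin n → ℤ) : 0 < σ.mono i :=
  Finset.prod_pos fun r _ => zpow_pos (σ r).2 _

theorem Radius.mono_add {n : ℕ} (σ : Radius n) (i j : Fin n → ℤ) :
    σ.mono (i + j) = σ.mono i * σ.mono j := by
  simp only [Radius.mono, Pi.add_apply, ← Finset.prod_mul_distrib]
  exact Finset.prod_congr rfl fun r _ => zpow_add₀ (σ r).2.ne' _ _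

theorem Radius.mono_zero {n : ℕ} (σ : Radius n) : σ.mono 0 = 1 := by
  simp [Radius.mono]

section Ring

variable {K : Type u} [NontriviallyNormedField K] {n : ℕ}

/-- The formal Laurent series `∑ fᵢ tⁱ` satisfies `|fᵢ| σ^i → 0` as `|i| → ∞`. -/
def ConvergesAt (f : (Fin n → ℤ) → K) (σ : Radius n) : Prop :=
  Tendsto (fun i => ‖f i‖ * σ.mono i) cofinite (𝓝 0)

/-- The product of formal Laurent series. -/
def convol (f g : (Fin n → ℤ) → K) : (Fin n → ℤ) → K :=
  fun i => ∑' j, f j * g (i - j)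

theorem tendsto_mul_cofinite {ι κ : Type*} {a : ι → ℝ} {b : κ → ℝ}
    (ha : Tendsto a cofinite (𝓝 0)) (hb : Tendsto b cofinite (𝓝 0)) :
    Tendsto (fun x : ι × κ => a x.1 * b x.2) cofinite (𝓝 0) :=
  tendsto_mul_cofinite_nhds_zero ha hb

theorem ConvergesAt.zero (σ : Radius n) : ConvergesAt (0 : (Fin n → ℤ) → K) σ := by
  simp [ConvergesAt, tendsto_const_nhds]

theorem ConvergesAt.neg {f : (Fin n → ℤ) → K} {σ : Radius n} (hf : ConvergesAt f σ) :
    ConvergesAt (-f) σ := by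
  simpa [ConvergesAt] using hf

theorem ConvergesAt.of_le {f g : (Fin n → ℤ) → K} {σ : Radius n} (hf : ConvergesAt f σ)
    (h : ∀ i, ‖g i‖ ≤ ‖f i‖) : ConvergesAt g σ :=
  squeeze_zero (fun i => mul_nonneg (norm_nonneg _) (σ.mono_pos i).le)
    (fun i => mul_le_mul_of_nonneg_right (h i) (σ.mono_pos i).le) hf

theorem ConvergesAt.add {f g : (Fin n → ℤ) → K} {σ : Radius n} (hf : ConvergesAt f σ)
    (hg : ConvergesAt g σ) : ConvergesAt (f + g) σ := by
  have h := Tendsto.add hf hg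
  rw [add_zero] at h
  refine squeeze_zero (fun i => mul_nonneg (norm_nonneg _) (σ.mono_pos i).le) (fun i => ?_) h
  rw [← add_mul]
  exact mul_le_mul_of_nonneg_right (norm_add_le _ _) (σ.mono_pos i).le

theorem ConvergesAt.smul {f : (Fin n → ℤ) → K} {σ : Radius n} (c : K) (hf : ConvergesAt f σ) :
    ConvergesAt (c • f) σ := by
  have h := Tendsto.const_mul ‖c‖ hf
  rw [mul_zero] at h
  simpa [ConvergesAt, mul_assoc] using h

theorem ConvergesAt.single (c : K) (σ : Radius n) :
    ConvergesAt (Pi.single (0 : Fin n → ℤ) c) σ := by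
  refine tendsto_nhds_of_eventually_eq ?_
  refine (Set.finite_singleton (0 : Fin n → ℤ)).subset fun i hi => ?_
  by_contra h
  exact hi (by simp [Pi.single_eq_of_ne h])

theorem ConvergesAt.tendsto_prod {f g : (Fin n → ℤ) → K} {σ : Radius n} (hf : ConvergesAt f σ)
    (hg : ConvergesAt g σ) :
    Tendsto (fun x : (Fin n → ℤ) × (Fin n → ℤ) => ‖f x.1 * g x.2‖ * σ.mono (x.1 + x.2))
      cofinite (𝓝 0) := by
  refine (tendsto_mul_cofinite hf hg).congr fun x => ?_
  rw [norm_mul, Radius.mono_add]; ring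

theorem convol_comm (f g : (Fin n → ℤ) → K) : convol f g = convol g f := by
  funext i
  rw [convol, convol, ← (Equiv.subLeft i).tsum_eq]
  simp [mul_comm]

theorem convol_single (c : K) (f : (Fin n → ℤ) → K) :
    convol (Pi.single 0 c) f = c • f := by
  funext i
  rw [convol, tsum_eq_single 0]
  · simp
  · intro j hj
    simp [Pi.single_eq_of_ne hj]

variable [IsUltrametricDist K]

theorem ConvergesAt.convol {f g : (Fin n → ℤ) → K} {σ : Radius n}
    (hf : ConvergesAt f σ) (hg : ConvergesAt g σ) : ConvergesAt (convol f g) σ := by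
  rw [ConvergesAt, Metric.tendsto_nhds]
  intro ε hε
  have h := (Metric.tendsto_nhds.1 (hf.tendsto_prod hg)) (ε / 2) (half_pos hε)
  refine (Set.Finite.image (fun x => x.1 + x.2) h).subset fun i hi => ?_
  by_contra hcon
  apply hi
  have hle : ∀ j, ‖f j * g (i - j)‖ ≤ ε / 2 * (σ.mono i)⁻¹ := by
    intro j
    by_contra hj
    refine hcon ⟨(j, i - j), ?_, by simp⟩
    intro hlt
    apply hj
    have h0 : (0 : ℝ) ≤ ‖f j * g (i - j)‖ * σ.mono i :=
      mul_nonneg (norm_nonneg _) (σ.mono_pos i).le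
    simp only [Set.mem_ofPred_eq, add_sub_cancel, dist_zero_right, Real.norm_of_nonneg h0] at hlt
    rw [← div_eq_mul_inv, le_div_iff₀ (σ.mono_pos i)]
    exact hlt.le
  have hs : ‖PFuchs.convol f g i‖ ≤ ε / 2 * (σ.mono i)⁻¹ :=
    IsUltrametricDist.norm_tsum_le_of_forall_le_of_nonneg
      (mul_nonneg (half_pos hε).le (inv_nonneg.2 (σ.mono_pos i).le)) hle
  have h0 : (0 : ℝ) ≤ ‖PFuchs.convol f g i‖ * σ.mono i :=
    mul_nonneg (norm_nonneg _) (σ.mono_pos i).le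
  simp only [Set.mem_ofPred_eq, dist_zero_right, Real.norm_of_nonneg h0]
  rw [← div_eq_mul_inv, le_div_iff₀ (σ.mono_pos i)] at hs
  linarith

variable [CompleteSpace K]

theorem summable_of_norm_tendsto {ι : Type*} {f : ι → K}
    (h : Tendsto (fun i => ‖f i‖) cofinite (𝓝 0)) : Summable f :=
  NonarchimedeanAddGroup.summable_of_tendsto_cofinite_zero (tendsto_zero_iff_norm_tendsto_zero.2 h)

theorem ConvergesAt.summable_convol {f g : (Fin n → ℤ) → K} {σ : Radius n}
    (hf : ConvergesAt f σ) (hg : ConvergesAt g σ) (i : Fin n → ℤ) :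
    Summable fun j => f j * g (i - j) := by
  apply summable_of_norm_tendsto
  have hinj : Function.Injective fun j : Fin n → ℤ => (j, i - j) := fun a b h => (Prod.ext_iff.1 h).1
  have h := ((hf.tendsto_prod hg).comp hinj.tendsto_cofinite).mul_const (σ.mono i)⁻¹
  rw [zero_mul] at h
  refine h.congr fun j => ?_
  simp [mul_assoc, (σ.mono_pos i).ne']

theorem convol_assoc {f g h : (Fin n → ℤ) → K} {σ : Radius n}
    (hf : ConvergesAt f σ) (hg : ConvergesAt g σ) (hh : ConvergesAt h σ) :
    convol (convol f g) h = convol f (convol g h) := by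
  funext i
  have hsum : Summable (Function.uncurry fun k j => f j * g (k - j) * h (i - k)) := by
    apply summable_of_norm_tendsto
    have h3 := tendsto_mul_cofinite hf (tendsto_mul_cofinite hg hh)
    have hinj : Function.Injective fun x : (Fin n → ℤ) × (Fin n → ℤ) =>
        (x.2, (x.1 - x.2, i - x.1)) := by
      rintro ⟨a, b⟩ ⟨c, d⟩ h
      simp only [Prod.mk.injEq] at h
      obtain ⟨rfl, h, -⟩ := h
      exact Prod.ext (sub_left_injective h) rfl
    have h4 := (h3.comp hinj.tendsto_cofinite).mul_const (σ.mono i)⁻¹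
    rw [zero_mul] at h4
    refine h4.congr fun x => ?_
    have he : σ.mono i = σ.mono x.2 * (σ.mono (x.1 - x.2) * σ.mono (i - x.1)) := by
      rw [← Radius.mono_add, ← Radius.mono_add]; congr 1; abel
    simp only [Function.comp, Function.uncurry, norm_mul]
    rw [mul_inv_eq_iff_eq_mul₀ (σ.mono_pos i).ne', he]
    ring
  calc convol (convol f g) h i = ∑' k, ∑' j, f j * g (k - j) * h (i - k) := by
        simp only [convol, tsum_mul_right]
    _ = ∑' j, ∑' k, f j * g (k - j) * h (i - k) := hsum.tsum_comm.symm
    _ = convol f (convol g h) i := by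
        refine tsum_congr fun j => ?_
        rw [convol, ← tsum_mul_left,
          ← (Equiv.subRight j).tsum_eq fun k => f j * (g k * h (i - j - k))]
        refine tsum_congr fun k => ?_
        rw [mul_assoc, Equiv.subRight_apply, sub_sub_sub_cancel_right]

theorem convol_add {f g h : (Fin n → ℤ) → K} {σ : Radius n}
    (hf : ConvergesAt f σ) (hg : ConvergesAt g σ) (hh : ConvergesAt h σ) :
    convol f (g + h) = convol f g + convol f h := by
  funext i
  simp only [convol, Pi.add_apply, mul_add]
  exact (hf.summable_convol hg i).tsum_add (hf.summable_convol hh i)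

end Ring

/-- The formal Laurent series in `n` variables over `K` that converge at all radii `σ` which are
eventual in `𝓕`. For `𝓕 = 𝓟 J` this is the ring `K_{J,n}` of the polyannulus of radius `J`
(convergence at every `σ ∈ J`); for `𝓕 = 𝓝 ρ` it is the union of the rings `K_{J,n}` over the closed
polysegments `J` that contain `ρ` in the interior. -/
def LaurentRing (K : Type u) [NontriviallyNormedField K] {n : ℕ} (𝓕 : Filter (Radius n)) : Type u :=
  {f : (Fin n → ℤ) → K // ∀ᶠ σ in 𝓕, ConvergesAt f σ}

namespace LaurentRing

variable {K : Type u} [NontriviallyNormedField K] {n : ℕ} {𝓕 : Filter (Radius n)}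

@[ext]
theorem ext {f g : LaurentRing K 𝓕} (h : f.1 = g.1) : f = g := Subtype.ext h

instance : Zero (LaurentRing K 𝓕) := ⟨⟨0, .of_forall fun σ => .zero σ⟩⟩
instance : One (LaurentRing K 𝓕) := ⟨⟨Pi.single 0 1, .of_forall fun σ => .single 1 σ⟩⟩
instance : Add (LaurentRing K 𝓕) :=
  ⟨fun f g => ⟨f.1 + g.1, by filter_upwards [f.2, g.2] with σ hf hg using hf.add hg⟩⟩
instance : Neg (LaurentRing K 𝓕) := ⟨fun f => ⟨-f.1, f.2.mono fun _ hf => hf.neg⟩⟩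
instance : SMul K (LaurentRing K 𝓕) := ⟨fun c f => ⟨c • f.1, f.2.mono fun _ hf => hf.smul c⟩⟩

variable [CompleteSpace K] [IsUltrametricDist K]

instance : Mul (LaurentRing K 𝓕) :=
  ⟨fun f g => ⟨convol f.1 g.1, by filter_upwards [f.2, g.2] with σ hf hg using hf.convol hg⟩⟩

instance [NeBot 𝓕] : CommRing (LaurentRing K 𝓕) where
  add_assoc f g h := ext (add_assoc f.1 g.1 h.1)
  zero_add f := ext (zero_add f.1)
  add_zero f := ext (add_zero f.1)
  add_comm f g := ext (add_comm f.1 g.1)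
  neg_add_cancel f := ext (neg_add_cancel f.1)
  nsmul := nsmulRec
  zsmul := zsmulRec
  mul_comm f g := ext (convol_comm f.1 g.1)
  mul_assoc f g h := by
    obtain ⟨σ, ⟨hf, hg⟩, hh⟩ := ((f.2.and g.2).and h.2).exists
    exact ext (convol_assoc hf hg hh)
  one_mul f := ext ((convol_single 1 f.1).trans (one_smul K f.1))
  mul_one f := ext ((convol_comm f.1 _).trans ((convol_single 1 f.1).trans (one_smul K f.1)))
  left_distrib f g h := by
    obtain ⟨σ, ⟨hf, hg⟩, hh⟩ := ((f.2.and g.2).and h.2).exists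
    exact ext (convol_add hf hg hh)
  right_distrib f g h := by
    obtain ⟨σ, ⟨hf, hg⟩, hh⟩ := ((f.2.and g.2).and h.2).exists
    refine ext ?_
    change convol (f.1 + g.1) h.1 = convol f.1 h.1 + convol g.1 h.1
    rw [convol_comm, convol_add hh hf hg, convol_comm h.1 f.1, convol_comm h.1 g.1]
  zero_mul f := ext (by funext i; change ∑' j, (0 : K) * f.1 (i - j) = 0; simp)
  mul_zero f := ext (by funext i; change ∑' j, f.1 j * (0 : K) = 0; simp)

instance [NeBot 𝓕] : Algebra K (LaurentRing K 𝓕) where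
  algebraMap :=
    { toFun := fun c => ⟨Pi.single 0 c, .of_forall fun σ => .single c σ⟩
      map_one' := rfl
      map_zero' := ext (Pi.single_zero _)
      map_add' := fun a b => ext (Pi.single_add _ _ _)
      map_mul' := fun a b => ext (by
        change _ = convol (Pi.single 0 a) (Pi.single 0 b)
        rw [convol_single, ← Pi.single_smul, smul_eq_mul]) }
  commutes' c f := mul_comm _ _
  smul_def' c f := ext (convol_single c f.1).symm

/-- The inclusion of rings of convergent Laurent series given by shrinking the set of radii. -/
def restrict {𝓕 𝓖 : Filter (Radius n)} [NeBot 𝓕] [NeBot 𝓖] (h : 𝓖 ≤ 𝓕) :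
    LaurentRing K 𝓕 →ₐ[K] LaurentRing K 𝓖 where
  toFun f := ⟨f.1, f.2.filter_mono h⟩
  map_one' := rfl
  map_mul' _ _ := rfl
  map_zero' := rfl
  map_add' _ _ := rfl
  commutes' _ := rfl

/-- The `i`-th coefficient. -/
def coeff [NeBot 𝓕] (i : Fin n → ℤ) : LaurentRing K 𝓕 →ₗ[K] K where
  toFun f := f.1 i
  map_add' _ _ := rfl
  map_smul' _ _ := rfl

open Classical in
/-- The part of the series `f` that is supported on `s`. -/
def part [NeBot 𝓕] (s : Set (Fin n → ℤ)) : LaurentRing K 𝓕 →ₗ[K] LaurentRing K 𝓕 where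
  toFun f := ⟨fun i => if i ∈ s then f.1 i else 0, f.2.mono fun _ hf => hf.of_le fun i => by
    split_ifs <;> simp⟩
  map_add' f g := ext (by
    funext i
    change (if i ∈ s then f.1 i + g.1 i else 0) = (if i ∈ s then f.1 i else 0) + if i ∈ s then g.1 i else 0
    split_ifs <;> simp)
  map_smul' c f := ext (by
    funext i
    change (if i ∈ s then c * f.1 i else 0) = c * if i ∈ s then f.1 i else 0
    split_ifs <;> simp)

/-- The `σ`-Gauss norm `|f|_σ = max_i |fᵢ| σ^i`. -/
def gaussNorm [NeBot 𝓕] (σ : Radius n) (f : LaurentRing K 𝓕) : ℝ := ⨆ i, ‖coeff i f‖ * σ.mono i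

end LaurentRing

section Gamma

variable (K : Type u) [NontriviallyNormedField K] (p : ℕ)

/-- The field `K(Γ)` generated by the `p`-power roots of unity in an algebraic closure of `K`. -/
abbrev KGamma : IntermediateField K (AlgebraicClosure K) :=
  IntermediateField.adjoin K {z | ∃ k : ℕ, z ^ p ^ k = 1}

/-- The group `Γ^n` of `n`-tuples of `p`-power roots of unity (they all lie in `K(Γ)`). -/
def GammaPow (n : ℕ) : Subgroup (Fin n → (KGamma K p)ˣ) where
  carrier := {ζ | ∃ k : ℕ, ∀ r, ζ r ^ p ^ k = 1}
  one_mem' := ⟨0, fun _ => one_pow _⟩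
  mul_mem' := by
    rintro ζ η ⟨k, hk⟩ ⟨l, hl⟩
    refine ⟨k + l, fun r => ?_⟩
    rw [Pi.mul_apply, mul_pow, pow_add, pow_mul, hk, one_pow, mul_comm (p ^ k), pow_mul, hl,
      one_pow, one_mul]
  inv_mem' := by
    rintro ζ ⟨k, hk⟩
    exact ⟨k, fun r => by rw [Pi.inv_apply, inv_pow, hk, inv_one]⟩

variable {K p} {n : ℕ}

/-- `ζ` lies in `Γ_k^n`, i.e. its entries are `p^k`-th roots of unity. -/
def GammaPow.InLevel (ζ : GammaPow K p n) (k : ℕ) : Prop := ∀ r, ζ.1 r ^ p ^ k = 1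

/-- The action of `Gal(K(Γ)/K)` on `Γ^n`. -/
def GammaPow.gal (τ : KGamma K p ≃ₐ[K] KGamma K p) (ζ : GammaPow K p n) : GammaPow K p n :=
  ⟨fun r => Units.map (τ : KGamma K p →* KGamma K p) (ζ.1 r), by
    obtain ⟨k, hk⟩ := ζ.2
    exact ⟨k, fun r => by rw [← map_pow, hk, map_one]⟩⟩

/-- `ζ^a = ζ₁^{a₁} ⋯ ζₙ^{aₙ}` for `ζ ∈ Γ_k^n` and `a ∈ ℤ_p^n`; it depends only on `a` modulo `p^k`. -/
def GammaPow.padicPow [Fact p.Prime] (ζ : GammaPow K p n) (k : ℕ) (a : Fin n → ℤ_[p]) : KGamma K p :=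
  ∏ r, (ζ.1 r : KGamma K p) ^ (PadicInt.toZModPow k (a r)).val

variable [CompleteSpace K] [IsUltrametricDist K] {𝓕 : Filter (Radius n)} [NeBot 𝓕]

variable (𝓕) in
/-- `K_{J,n} ⊗_K K(Γ)`, respectively `R_ρ ⊗_K K(Γ)`. -/
abbrev LaurentRingGamma (K : Type u) [NontriviallyNormedField K] (p : ℕ) [CompleteSpace K]
    [IsUltrametricDist K] : Type u := LaurentRing K 𝓕 ⊗[K] KGamma K p

/-- The `i`-th coefficient, in `K(Γ)`, of an element of `K_{J,n} ⊗_K K(Γ)`. -/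
def LaurentRingGamma.coeff (i : Fin n → ℤ) : LaurentRingGamma 𝓕 K p →ₗ[K] KGamma K p :=
  (TensorProduct.lid K (KGamma K p)).toLinearMap ∘ₗ
    LinearMap.rTensor (KGamma K p) (LaurentRing.coeff i)

/-- The `σ`-Gauss norm on `K_{J,n} ⊗_K K(Γ)`; `K(Γ)` carries the unique norm extending that of `K`. -/
def LaurentRingGamma.gaussNorm (σ : Radius n) (f : LaurentRingGamma 𝓕 K p) : ℝ :=
  ⨆ i, spectralNorm K (KGamma K p) (LaurentRingGamma.coeff i f) * σ.mono i

/-- The `K(Γ)`-linear action `f(t) ↦ f(ζt)` of `ζ ∈ Γ^n` on `K_{J,n} ⊗_K K(Γ)`. If `N` is the order of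
`ζ`, the factor `ζ^i` depends only on `i` modulo `N`, so that `f(ζt)` for `f ∈ K_{J,n}` is the finite
sum over the residue classes `a` modulo `N` of `ζ^a` times the part of `f` in the class `a`; see
`LaurentRingGamma.coeff_twist`. -/
def LaurentRingGamma.twist (ζ : GammaPow K p n) :
    LaurentRingGamma 𝓕 K p →ₗ[K] LaurentRingGamma 𝓕 K p :=
  ∑ a : Fin n → Fin (orderOf ζ),
    TensorProduct.map (LaurentRing.part {i | ∀ r, i r ≡ (a r : ℕ) [ZMOD orderOf ζ]})
      (LinearMap.mulLeft K (∏ r, (ζ.1 r : KGamma K p) ^ (a r : ℕ)))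

theorem LaurentRingGamma.coeff_twist [hp : Fact p.Prime] (ζ : GammaPow K p n) (i : Fin n → ℤ)
    (f : LaurentRingGamma 𝓕 K p) :
    coeff i (twist ζ f) = ((∏ r, ζ.1 r ^ i r : (KGamma K p)ˣ) : KGamma K p) * coeff i f := by
  classical
  have hN : 0 < orderOf ζ := by
    obtain ⟨k, hk⟩ := ζ.2
    exact orderOf_pos_iff.2 (isOfFinOrder_iff_pow_eq_one.2
      ⟨p ^ k, pow_pos hp.out.pos k, Subtype.ext (funext fun r => hk r)⟩)
  have hN' : (orderOf ζ : ℤ) ≠ 0 := by exact_mod_cast hN.ne'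
  have hζ : ∀ r, ζ.1 r ^ (orderOf ζ : ℤ) = 1 := fun r => by
    have h := congrFun (congrArg Subtype.val (pow_orderOf_eq_one ζ)) r
    rw [zpow_natCast]
    exact h
  have hb : ∀ r, (i r % orderOf ζ).toNat < orderOf ζ := fun r => by
    have h0 := Int.emod_nonneg (i r) hN'
    have h1 := Int.emod_lt_of_pos (i r) (Int.natCast_pos.2 hN)
    omega
  induction f using TensorProduct.induction_on with
  | zero => simp
  | add x y hx hy => rw [map_add, map_add, map_add, mul_add, hx, hy]
  | tmul g c =>
    have key : ∀ a : Fin n → Fin (orderOf ζ),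
        coeff i (TensorProduct.map
          (LaurentRing.part {i | ∀ r, i r ≡ (a r : ℕ) [ZMOD orderOf ζ]})
          (LinearMap.mulLeft K (∏ r, (ζ.1 r : KGamma K p) ^ (a r : ℕ))) (g ⊗ₜ[K] c)) =
        if a = fun r => ⟨(i r % orderOf ζ).toNat, hb r⟩ then
          ((∏ r, ζ.1 r ^ i r : (KGamma K p)ˣ) : KGamma K p) * coeff i (g ⊗ₜ[K] c) else 0 := by
      intro a
      have hiff : (∀ r, i r ≡ (a r : ℕ) [ZMOD orderOf ζ]) ↔
          a = fun r => ⟨(i r % orderOf ζ).toNat, hb r⟩ := by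
        rw [funext_iff]
        refine forall_congr' fun r => ?_
        have h0 := Int.emod_nonneg (i r) hN'
        have ha := Int.emod_eq_of_lt (Int.natCast_nonneg (a r : ℕ))
          (Int.ofNat_lt.2 (a r).2)
        rw [Int.ModEq, ha, Fin.ext_iff]
        simp only
        omega
      have hc : coeff i (TensorProduct.map
          (LaurentRing.part {i | ∀ r, i r ≡ (a r : ℕ) [ZMOD orderOf ζ]})
          (LinearMap.mulLeft K (∏ r, (ζ.1 r : KGamma K p) ^ (a r : ℕ))) (g ⊗ₜ[K] c)) =
          (if (∀ r, i r ≡ (a r : ℕ) [ZMOD orderOf ζ]) then g.1 i else 0) •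
            ((∏ r, (ζ.1 r : KGamma K p) ^ (a r : ℕ)) * c) := by
        simp only [coeff, LaurentRing.coeff, LaurentRing.part, LinearMap.comp_apply,
          TensorProduct.map_tmul, LinearMap.rTensor_tmul, LinearEquiv.coe_coe,
          TensorProduct.lid_tmul, LinearMap.coe_mk, AddHom.coe_mk, LinearMap.mulLeft_apply,
          Set.mem_ofPred_eq]
        congr 1
        change (@ite _ (∀ r, i r ≡ (a r : ℕ) [ZMOD orderOf ζ]) (Classical.propDecidable _) _ _) = _
        congr
      rw [hc]
      by_cases h : ∀ r, i r ≡ (a r : ℕ) [ZMOD orderOf ζ]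
      · rw [if_pos h, if_pos (hiff.1 h)]
        have hpow : (∏ r, (ζ.1 r : KGamma K p) ^ (a r : ℕ)) =
            ((∏ r, ζ.1 r ^ i r : (KGamma K p)ˣ) : KGamma K p) := by
          rw [Units.coe_prod]
          refine Finset.prod_congr rfl fun r _ => ?_
          obtain ⟨q, hq⟩ := (h r).dvd
          have : i r = (a r : ℕ) + orderOf ζ * (-q) := by linarith
          rw [this, zpow_add, zpow_mul, hζ, one_zpow, mul_one, zpow_natCast, Units.val_pow_eq_pow_val]
        rw [hpow]
        simp [coeff, LaurentRing.coeff]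
      · rw [if_neg h, if_neg (fun h' => h (hiff.2 h')), zero_smul]
    rw [twist, LinearMap.sum_apply, map_sum, Finset.sum_congr rfl fun a _ => key a]
    simp

end Gamma

section Objects

variable (K : Type u) [NontriviallyNormedField K] [CompleteSpace K] [IsUltrametricDist K]
  (p : ℕ) {n : ℕ}

/-- The natural action of `K_{J,n} ⊗_K K(Γ)` on `P ⊗_K K(Γ)` for a `K_{J,n}`-module `P`:
`(f ⊗ c) (x ⊗ d) = (f x) ⊗ (c d)`. -/
def scalarAction (𝓕 : Filter (Radius n)) [NeBot 𝓕] (P : Type v) [AddCommGroup P] [Module K P]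
    [Module (LaurentRing K 𝓕) P] [IsScalarTower K (LaurentRing K 𝓕) P] :
    LaurentRingGamma 𝓕 K p →ₐ[K] Module.End K (P ⊗[K] KGamma K p) :=
  (Module.endTensorEndAlgHom (R := K) (S := K) (A := K)).comp
    (Algebra.TensorProduct.map (Algebra.lsmul K K P) (Algebra.lsmul K K (KGamma K p)))

/-- A module `P` over `K_{J,n}` (or `R_ρ`) with a semilinear group action of `Γ^n` on
`P ⊗_K K(Γ)`. -/
structure GammaModule (𝓕 : Filter (Radius n)) [NeBot 𝓕] where
  carrier : Type v
  [addCommGroup : AddCommGroup carrier]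
  [moduleK : Module K carrier]
  [module : Module (LaurentRing K 𝓕) carrier]
  [isScalarTower : IsScalarTower K (LaurentRing K 𝓕) carrier]
  act : GammaPow K p n →* Module.End K (carrier ⊗[K] KGamma K p)
  semilinear : ∀ (ζ : GammaPow K p n) (c : LaurentRingGamma 𝓕 K p) (x : carrier ⊗[K] KGamma K p),
    act ζ (scalarAction K p 𝓕 carrier c x) =
      scalarAction K p 𝓕 carrier (LaurentRingGamma.twist ζ c) (act ζ x)

attribute [instance] GammaModule.addCommGroup GammaModule.moduleK GammaModule.module
  GammaModule.isScalarTower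

/-- A closed polysegment `[α, β] = ∏ [αᵢ, βᵢ]` in `ℝ_{>0}^n` that contains `ρ` in its interior. -/
structure ClosedPolysegment (ρ : Radius n) where
  lo : Radius n
  hi : Radius n
  lo_lt : ∀ r, lo r < ρ r
  lt_hi : ∀ r, ρ r < hi r

namespace ClosedPolysegment

variable {ρ : Radius n}

def toSet (J : ClosedPolysegment ρ) : Set (Radius n) := Set.Icc J.lo J.hi

def filter (J : ClosedPolysegment ρ) : Filter (Radius n) := 𝓟 J.toSet

theorem mem_nhds (J : ClosedPolysegment ρ) : J.toSet ∈ 𝓝 ρ := by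
  rw [toSet, ← Set.pi_univ_Icc]
  exact set_pi_mem_nhds Set.finite_univ fun r _ => Icc_mem_nhds (J.lo_lt r) (J.lt_hi r)

theorem nhds_le (J : ClosedPolysegment ρ) : 𝓝 ρ ≤ J.filter := le_principal_iff.2 J.mem_nhds

instance (J : ClosedPolysegment ρ) : NeBot J.filter := neBot_of_le J.nhds_le

end ClosedPolysegment

variable {ρ : Radius n}

/-- The coordinate ring `K_{J,n}` of the closed polyannulus of radius `J`. -/
abbrev PolyannulusRing (J : ClosedPolysegment ρ) : Type u := LaurentRing K J.filter

variable (ρ) in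
/-- The ring `R_ρ`, the direct limit (union) of the rings `K_{J,n}` over all closed polysegments `J`
containing `ρ` in the interior. -/
abbrev GermRing : Type u := LaurentRing K (𝓝 ρ)

instance (J : ClosedPolysegment ρ) : Algebra (PolyannulusRing K J) (GermRing K ρ) :=
  (LaurentRing.restrict J.nhds_le).toRingHom.toAlgebra

instance (J : ClosedPolysegment ρ) : IsScalarTower K (PolyannulusRing K J) (GermRing K ρ) :=
  IsScalarTower.of_algebraMap_eq fun _ => rfl

variable {K p}

/-- The matrix `E(ζ)` of `ζ^*` with respect to a basis `e` of `P`: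
`ζ^*(e_j ⊗ 1) = ∑ᵢ E(ζ)ᵢⱼ (eᵢ ⊗ 1)`. -/
def GammaModule.reprMatrix {𝓕 : Filter (Radius n)} [NeBot 𝓕] (P : GammaModule.{u, v} K p 𝓕)
    {m : ℕ} (e : Module.Basis (Fin m) (LaurentRing K 𝓕) P.carrier) (ζ : GammaPow K p n) :
    Matrix (Fin m) (Fin m) (LaurentRingGamma 𝓕 K p) :=
  Matrix.of fun i j =>
    LinearMap.rTensor (KGamma K p) ((e.coord i).restrictScalars K) (P.act ζ (e j ⊗ₜ[K] 1))

/-- The map `P' ⊗_K K(Γ) → P ⊗_K K(Γ)` induced by an isomorphism `R_ρ ⊗ P' ≅ P`. -/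
def gammaMap {J : ClosedPolysegment ρ} {P' : GammaModule.{u, w} K p J.filter}
    {P : GammaModule.{u, v} K p (𝓝 ρ)}
    (φ : (GermRing K ρ ⊗[PolyannulusRing K J] P'.carrier) ≃ₗ[GermRing K ρ] P.carrier) :
    P'.carrier ⊗[K] KGamma K p →ₗ[K] P.carrier ⊗[K] KGamma K p :=
  LinearMap.rTensor (KGamma K p) (φ.toLinearMap.restrictScalars K ∘ₗ
    (TensorProduct.mk (PolyannulusRing K J) (GermRing K ρ) P'.carrier 1).restrictScalars K)

/-- `P` is defined by `P'` over `J`: `P'` is a finite free `K_{J,n}`-module with a semilinear action of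
`Γ^n` on `P' ⊗_K K(Γ)`, an isomorphism `R_ρ ⊗ P' ≅ P` under which the action on `P ⊗_K K(Γ)` is
induced from that on `P' ⊗_K K(Γ)`, and `|E(ζ)|_J ≤ p^{lk}` for all `ζ ∈ Γ_k^n` with respect to
some basis of `P'`. -/
structure Model (P : GammaModule.{u, v} K p (𝓝 ρ)) (J : ClosedPolysegment ρ) where
  toGammaModule : GammaModule.{u, w} K p J.filter
  extend : (GermRing K ρ ⊗[PolyannulusRing K J] toGammaModule.carrier) ≃ₗ[GermRing K ρ] P.carrier
  act_extend : ∀ (ζ : GammaPow K p n) (x : toGammaModule.carrier ⊗[K] KGamma K p),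
    gammaMap extend (toGammaModule.act ζ x) =
      P.act ζ (gammaMap extend x)
  bound : ∃ (m : ℕ) (e : Module.Basis (Fin m) (PolyannulusRing K J) toGammaModule.carrier),
    ∃ l : ℝ, 0 < l ∧ ∀ k : ℕ, 0 < k → ∀ ζ : GammaPow K p n, GammaPow.InLevel ζ k → ∀ i j, ∀ σ ∈ J.toSet,
      LaurentRingGamma.gaussNorm σ (toGammaModule.reprMatrix e ζ i j) ≤ (p : ℝ) ^ (l * k)

variable (K p ρ) in
/-- The objects of the category `𝒞_ρ`. -/
structure CObj where
  toGammaModule : GammaModule.{u, v} K p (𝓝 ρ)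
  finite : Module.Finite (GermRing K ρ) toGammaModule.carrier
  free : Module.Free (GermRing K ρ) toGammaModule.carrier
  exists_model : ∃ J : ClosedPolysegment ρ, Nonempty (Model.{u, v, u} toGammaModule J)
  equivariant : ∀ (τ : KGamma K p ≃ₐ[K] KGamma K p) (ζ : GammaPow K p n)
      (x : toGammaModule.carrier ⊗[K] KGamma K p),
    LinearMap.lTensor toGammaModule.carrier τ.toLinearMap (toGammaModule.act ζ x) =
      toGammaModule.act (GammaPow.gal τ ζ) (LinearMap.lTensor toGammaModule.carrier τ.toLinearMap x)

variable [Fact p.Prime]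

/-- The tuple `A = (A_1, …, A_m)` in `ℤ_p^n` is an exponent admitted by the model `P'` over `J`: for
a basis `e` of `P'` there are matrices `S_k` over `K_{J,n}`, `k ≥ 1`, such that the columns `v_j` of
`(e_1, …, e_m) S_k` satisfy `ζ^*(v_j) = ζ^{A_j} v_j` for `ζ ∈ Γ_k^n`, `|S_k|_J ≤ p^{lk}` for some
`l > 0` independent of `k`, and `|det S_k|_σ ≥ 1` for all `σ ∈ J`. -/
def Model.IsExponent {P : GammaModule.{u, v} K p (𝓝 ρ)} {J : ClosedPolysegment ρ}
    (P' : Model.{u, v, w} P J) {m : ℕ} (A : Fin m → Fin n → ℤ_[p]) : Prop :=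
  ∃ (e : Module.Basis (Fin m) (PolyannulusRing K J) P'.toGammaModule.carrier)
    (S : ℕ → Matrix (Fin m) (Fin m) (PolyannulusRing K J)),
    (∀ k : ℕ, 0 < k → ∀ ζ : GammaPow K p n, GammaPow.InLevel ζ k → ∀ j,
      P'.toGammaModule.act ζ ((∑ i, S k i j • e i) ⊗ₜ[K] 1) =
        (∑ i, S k i j • e i) ⊗ₜ[K] GammaPow.padicPow ζ k (A j)) ∧
    (∃ l : ℝ, 0 < l ∧ ∀ k : ℕ, 0 < k → ∀ i j, ∀ σ ∈ J.toSet,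
      LaurentRing.gaussNorm σ (S k i j) ≤ (p : ℝ) ^ (l * k)) ∧
    (∀ k : ℕ, 0 < k → ∀ σ ∈ J.toSet, 1 ≤ LaurentRing.gaussNorm σ (S k).det)

/-- `A` is an exponent of the object `P` of `𝒞_ρ`: it is admitted by some model of `P` over some
closed polysegment containing `ρ` in its interior. (Every model is isomorphic to one whose carrier
is `K_{J,n}^m`, in the universe of `K`.) -/
def CObj.IsExponent (P : CObj.{u, v} K p ρ) {m : ℕ} (A : Fin m → Fin n → ℤ_[p]) : Prop :=
  ∃ (J : ClosedPolysegment ρ) (P' : Model.{u, v, u} P.toGammaModule J), P'.IsExponent A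

end Objects

section Exponents

variable {p : ℕ} [Fact p.Prime]

/-- `⟨x⟩`: the smallest nonnegative `a ∈ ℤ[1/p]` such that `x - a` or `x + a` is a `p`-adic
integer. -/
def angle (x : ℚ_[p]) : ℝ :=
  sInf {a : ℝ | 0 ≤ a ∧ ∃ (b : ℤ) (s : ℕ), a = b / (p : ℝ) ^ s ∧
    (‖x - b / (p : ℚ_[p]) ^ s‖ ≤ 1 ∨ ‖x + b / (p : ℚ_[p]) ^ s‖ ≤ 1)}

/-- Weak equivalence of two multisubsets `{A_1, …, A_m}` and `{B_1, …, B_m}` of `ℤ_p^n`. -/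
def WeaklyEquivalent {m n : ℕ} (A B : Fin m → Fin n → ℤ_[p]) : Prop :=
  ∃ c : ℝ, 0 < c ∧ ∃ σ : ℕ → Equiv.Perm (Fin m), ∀ h : ℕ, 0 < h → ∀ (i : Fin n) (j : Fin m),
    (p : ℝ) ^ h * angle (((A (σ h j) i - B j i : ℤ_[p]) : ℚ_[p]) / (p : ℚ_[p]) ^ h) ≤ c * h

end Exponents

end PFuchs

end

/-!
Transport the matrices `S_k` and `T_k` witnessing two exponents `A` and `B` to `R_ρ`, with
respect to one basis of `P`, and put `d = det S_k` and `N = adj(S_k) T_k`. For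
`ζ = (1, …, z, …, 1)` with `z` a `p^k`-th root of unity in the `r`-th place, semilinearity gives
`d(t) z^{A_i^r} N_ij(ζt) = d(ζt) z^{B_j^r} N_ij(t)`. Fourier inversion over `z` turns this into
the statement that the ratio of `d` and `N_ij` is homogeneous of degree `A_i^r - B_j^r` for the
`ℤ/p^k`-grading by the exponent of `t_r`. Since the Gauss norm at `ρ` is multiplicative, `d` and
`N_ij` then have dominant terms at `ρ` whose `r`-th exponents differ by `A_i^r - B_j^r` modulo
`p^k`. When the norm of `N_ij` at `ρ` is not exponentially small in `k`, comparing the dominant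
terms at `ρ` with the Gauss norms at radii slightly to the left and right of `ρ` in the `r`-th
direction, which grow at most exponentially, shows that these exponents are `O(k)`. A large term
of the Leibniz expansion of `det N` provides a permutation along which `N_ij` is never
exponentially small.
-/

noncomputable section

namespace PFuchs

open Filter Topology TensorProduct

section NullFamilies

theorem exists_forall_le_of_tendsto_cofinite_zero {ι : Type*} [Nonempty ι] {a : ι → ℝ}
    (h₀ : ∀ i, 0 ≤ a i) (ha : Tendsto a cofinite (𝓝 0)) : ∃ i, ∀ j, a j ≤ a i := by
  by_cases! h : ∃ i, 0 < a i
  · obtain ⟨i, hi⟩ := h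
    have hfin : {j | ¬ a j < a i}.Finite := ha.eventually_lt_const hi
    obtain ⟨k, hk, hmax⟩ := Set.exists_max_image _ a hfin ⟨i, lt_irrefl (a i)⟩
    refine ⟨k, fun j => ?_⟩
    by_cases hj : a j < a i
    · exact hj.le.trans (not_lt.1 hk)
    · exact hmax j hj
  · exact ⟨Classical.arbitrary ι, fun j => (h j).trans (h₀ _)⟩

variable {E ι : Type*} [NormedAddCommGroup E] [IsUltrametricDist E] {u : ι → E}

theorem norm_tsum_lt_of_forall_lt (hu : Summable u) {C : ℝ} (hC : 0 < C) (h : ∀ i, ‖u i‖ < C) :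
    ‖∑' i, u i‖ < C := by
  cases isEmpty_or_nonempty ι
  · simpa using hC
  obtain ⟨i, hi⟩ := exists_forall_le_of_tendsto_cofinite_zero (fun _ => norm_nonneg _)
    (tendsto_zero_iff_norm_tendsto_zero.1 hu.tendsto_cofinite_zero)
  exact (IsUltrametricDist.norm_tsum_le_of_forall_le hi).trans_lt (h i)

theorem norm_tsum_eq_of_dominant [CompleteSpace E] (hu : Summable u) {i : ι} (hi : u i ≠ 0)
    (h : ∀ j, j ≠ i → ‖u j‖ < ‖u i‖) : ‖∑' j, u j‖ = ‖u i‖ := by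
  classical
  have hrest : ‖∑' j, if j = i then 0 else u j‖ < ‖u i‖ := by
    have hsum : Summable fun j => if j = i then 0 else u j :=
      (hu.update i 0).congr fun j => by simp only [Function.update_apply]
    refine norm_tsum_lt_of_forall_lt hsum (norm_pos_iff.2 hi) fun j => ?_
    split_ifs with hj
    · simpa using hi
    · exact h j hj
  rw [hu.tsum_eq_add_tsum_ite i, IsUltrametricDist.norm_add_eq_max_of_norm_ne_norm hrest.ne',
    max_eq_left hrest.le]

end NullFamilies

section GaussNorm

variable {K : Type u} [NontriviallyNormedField K] {n : ℕ} {σ : Radius n}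

theorem ConvergesAt.exists_forall_le {f : (Fin n → ℤ) → K} (hf : ConvergesAt f σ) :
    ∃ i, ∀ j, ‖f j‖ * σ.mono j ≤ ‖f i‖ * σ.mono i :=
  exists_forall_le_of_tendsto_cofinite_zero
    (fun i => mul_nonneg (norm_nonneg _) (σ.mono_pos i).le) hf

theorem norm_mul_mono_add (a b : K) (i j : Fin n → ℤ) :
    ‖a * b‖ * σ.mono (i + j) = (‖a‖ * σ.mono i) * (‖b‖ * σ.mono j) := by
  rw [Radius.mono_add, norm_mul, mul_mul_mul_comm]

theorem LaurentRing.convergesAt {𝓕 : Filter (Radius n)} (hσ : pure σ ≤ 𝓕) (f : LaurentRing K 𝓕) :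
    ConvergesAt f.1 σ :=
  eventually_pure.1 (f.2.filter_mono hσ)

theorem LaurentRing.convergesAt_mul [IsUltrametricDist K] {𝓕 : Filter (Radius n)}
    {f g : LaurentRing K 𝓕} (hf : ConvergesAt f.1 σ) (hg : ConvergesAt g.1 σ) :
    ConvergesAt (f * g).1 σ :=
  hf.convol hg

variable {𝓕 : Filter (Radius n)} [NeBot 𝓕] [CompleteSpace K] [IsUltrametricDist K]

namespace LaurentRing

variable {f g : LaurentRing K 𝓕}

instance : Nontrivial (LaurentRing K 𝓕) := ⟨1, 0, fun h => by
  have h₀ : (Pi.single (0 : Fin n → ℤ) (1 : K) : (Fin n → ℤ) → K) 0 = 0 :=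
    congrFun (congrArg Subtype.val h) 0
  simp at h₀⟩

theorem le_gaussNorm (hf : ConvergesAt f.1 σ) (i : Fin n → ℤ) :
    ‖f.1 i‖ * σ.mono i ≤ f.gaussNorm σ := by
  obtain ⟨j, hj⟩ := hf.exists_forall_le
  exact le_ciSup (f := fun i => ‖f.1 i‖ * σ.mono i) ⟨_, Set.forall_mem_range.2 hj⟩ i

theorem gaussNorm_le {c : ℝ} (h : ∀ i, ‖f.1 i‖ * σ.mono i ≤ c) : f.gaussNorm σ ≤ c :=
  ciSup_le h

theorem exists_eq_gaussNorm (hf : ConvergesAt f.1 σ) :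
    ∃ i, ‖f.1 i‖ * σ.mono i = f.gaussNorm σ := by
  obtain ⟨i, hi⟩ := hf.exists_forall_le
  exact ⟨i, le_antisymm (le_gaussNorm hf i) (gaussNorm_le hi)⟩

theorem gaussNorm_nonneg (f : LaurentRing K 𝓕) : 0 ≤ f.gaussNorm σ :=
  Real.iSup_nonneg fun i => mul_nonneg (norm_nonneg _) (σ.mono_pos i).le

theorem gaussNorm_eq_zero_iff (hf : ConvergesAt f.1 σ) : f.gaussNorm σ = 0 ↔ f = 0 := by
  refine ⟨fun h => ext (funext fun i => ?_), ?_⟩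
  · have hi : ‖f.1 i‖ * σ.mono i ≤ 0 := (le_gaussNorm hf i).trans_eq h
    exact norm_le_zero_iff.1 (nonpos_of_mul_nonpos_left hi (σ.mono_pos i))
  · rintro rfl
    exact (gaussNorm_le fun i => le_of_eq
      (by simp [show (0 : LaurentRing K 𝓕).1 i = 0 from rfl])).antisymm (gaussNorm_nonneg 0)

theorem gaussNorm_pos (hf : ConvergesAt f.1 σ) (hne : f ≠ 0) : 0 < f.gaussNorm σ :=
  (gaussNorm_nonneg f).lt_of_ne' (mt (gaussNorm_eq_zero_iff hf).1 hne)

theorem gaussNorm_add_le (hf : ConvergesAt f.1 σ) (hg : ConvergesAt g.1 σ) :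
    (f + g).gaussNorm σ ≤ f.gaussNorm σ + g.gaussNorm σ :=
  gaussNorm_le fun i => calc
    ‖f.1 i + g.1 i‖ * σ.mono i ≤ ‖f.1 i‖ * σ.mono i + ‖g.1 i‖ * σ.mono i := by
      rw [← add_mul]
      exact mul_le_mul_of_nonneg_right (norm_add_le _ _) (σ.mono_pos i).le
    _ ≤ f.gaussNorm σ + g.gaussNorm σ := add_le_add (le_gaussNorm hf i) (le_gaussNorm hg i)

theorem gaussNorm_neg (f : LaurentRing K 𝓕) : (-f).gaussNorm σ = f.gaussNorm σ :=
  iSup_congr fun i => congrArg (· * σ.mono i) (norm_neg (f.1 i))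

theorem gaussNorm_mul_le (hf : ConvergesAt f.1 σ) (hg : ConvergesAt g.1 σ) :
    (f * g).gaussNorm σ ≤ f.gaussNorm σ * g.gaussNorm σ := by
  refine gaussNorm_le fun i => ?_
  rw [← le_div_iff₀ (σ.mono_pos i)]
  refine IsUltrametricDist.norm_tsum_le_of_forall_le fun j => ?_
  rw [le_div_iff₀ (σ.mono_pos i)]
  calc ‖f.1 j * g.1 (i - j)‖ * σ.mono i
      = (‖f.1 j‖ * σ.mono j) * (‖g.1 (i - j)‖ * σ.mono (i - j)) := by
        rw [← norm_mul_mono_add, add_sub_cancel]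
    _ ≤ f.gaussNorm σ * g.gaussNorm σ :=
        mul_le_mul (le_gaussNorm hf _) (le_gaussNorm hg _)
          (mul_nonneg (norm_nonneg _) (σ.mono_pos _).le) (gaussNorm_nonneg f)

theorem exists_min_toLex_eq_gaussNorm (hf : ConvergesAt f.1 σ) (hne : f ≠ 0) :
    ∃ i, ‖f.1 i‖ * σ.mono i = f.gaussNorm σ ∧
      ∀ j, ‖f.1 j‖ * σ.mono j = f.gaussNorm σ → toLex i ≤ toLex j := by
  have hfin : {j | ‖f.1 j‖ * σ.mono j = f.gaussNorm σ}.Finite :=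
    Set.Finite.subset (hf.eventually_lt_const (gaussNorm_pos hf hne)) fun _ hj hlt => hlt.ne hj
  exact Set.exists_min_image _ toLex hfin (exists_eq_gaussNorm hf)

theorem mul_lt_gaussNorm_mul_gaussNorm {i j : Fin n → ℤ} (hf : ConvergesAt f.1 σ)
    (hg : ConvergesAt g.1 σ) (hf₀ : f ≠ 0) (hg₀ : g ≠ 0)
    (h : ‖f.1 i‖ * σ.mono i ≠ f.gaussNorm σ ∨ ‖g.1 j‖ * σ.mono j ≠ g.gaussNorm σ) :
    (‖f.1 i‖ * σ.mono i) * (‖g.1 j‖ * σ.mono j) < f.gaussNorm σ * g.gaussNorm σ := by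
  rcases h with hi | hj
  · exact mul_lt_mul_of_lt_of_le_of_nonneg_of_pos ((le_gaussNorm hf i).lt_of_ne hi)
      (le_gaussNorm hg j) (mul_nonneg (norm_nonneg _) (σ.mono_pos _).le) (gaussNorm_pos hg hg₀)
  · exact mul_lt_mul_of_le_of_lt_of_nonneg_of_pos (le_gaussNorm hf i)
      ((le_gaussNorm hg j).lt_of_ne hj) (mul_nonneg (norm_nonneg _) (σ.mono_pos _).le)
      (gaussNorm_pos hf hf₀)

/- The product of the lexicographically smallest terms of maximal norm dominates its coefficient. -/
theorem le_gaussNorm_mul (hf : ConvergesAt f.1 σ) (hg : ConvergesAt g.1 σ) (hf₀ : f ≠ 0)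
    (hg₀ : g ≠ 0) : f.gaussNorm σ * g.gaussNorm σ ≤ (f * g).gaussNorm σ := by
  obtain ⟨i, hi, himin⟩ := exists_min_toLex_eq_gaussNorm hf hf₀
  obtain ⟨j, hj, hjmin⟩ := exists_min_toLex_eq_gaussNorm hg hg₀
  have hij : ‖f.1 i * g.1 (i + j - i)‖ * σ.mono (i + j) = f.gaussNorm σ * g.gaussNorm σ := by
    rw [add_sub_cancel_left, norm_mul_mono_add, hi, hj]
  have hne : f.1 i * g.1 (i + j - i) ≠ 0 := fun h₀ => by
    rw [h₀, norm_zero, zero_mul] at hij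
    exact (mul_pos (gaussNorm_pos hf hf₀) (gaussNorm_pos hg hg₀)).ne hij
  have hlt : ∀ l, l ≠ i → ‖f.1 l * g.1 (i + j - l)‖ < ‖f.1 i * g.1 (i + j - i)‖ := by
    intro l hl
    have hl_eq := norm_mul_mono_add (σ := σ) (f.1 l) (g.1 (i + j - l)) l (i + j - l)
    rw [add_sub_cancel] at hl_eq
    rw [← mul_lt_mul_iff_of_pos_right (σ.mono_pos (i + j)), hij, hl_eq]
    refine mul_lt_gaussNorm_mul_gaussNorm hf hg hf₀ hg₀ ?_
    by_contra! hmax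
    have hil : toLex i < toLex l :=
      (himin l hmax.1).lt_of_ne fun h => hl (toLex.injective h).symm
    have hsum := add_lt_add_of_lt_of_le hil (hjmin _ hmax.2)
    rw [← toLex_add, ← toLex_add, add_sub_cancel] at hsum
    exact hsum.false
  calc f.gaussNorm σ * g.gaussNorm σ = ‖(f * g).1 (i + j)‖ * σ.mono (i + j) := by
        rw [← hij]
        exact congrArg (· * _) (norm_tsum_eq_of_dominant (hf.summable_convol hg _) hne hlt).symm
    _ ≤ (f * g).gaussNorm σ := le_gaussNorm (convergesAt_mul hf hg) _

/-- The Gauss norm at a radius of convergence `σ`, as an absolute value. -/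
def gaussAbv (hσ : pure σ ≤ 𝓕) : AbsoluteValue (LaurentRing K 𝓕) ℝ where
  toFun := gaussNorm σ
  map_mul' f g := by
    refine (gaussNorm_mul_le (f.convergesAt hσ) (g.convergesAt hσ)).antisymm ?_
    rcases eq_or_ne f 0 with rfl | hf₀
    · rw [(gaussNorm_eq_zero_iff (convergesAt hσ 0)).2 rfl, zero_mul]
      exact gaussNorm_nonneg _
    rcases eq_or_ne g 0 with rfl | hg₀
    · rw [(gaussNorm_eq_zero_iff (convergesAt hσ 0)).2 rfl, mul_zero]
      exact gaussNorm_nonneg _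
    exact le_gaussNorm_mul (f.convergesAt hσ) (g.convergesAt hσ) hf₀ hg₀
  nonneg' := gaussNorm_nonneg
  eq_zero' f := gaussNorm_eq_zero_iff (f.convergesAt hσ)
  add_le' f g := gaussNorm_add_le (f.convergesAt hσ) (g.convergesAt hσ)

theorem gaussNorm_mul (hσ : pure σ ≤ 𝓕) (f g : LaurentRing K 𝓕) :
    (f * g).gaussNorm σ = f.gaussNorm σ * g.gaussNorm σ :=
  map_mul (gaussAbv hσ) f g

end LaurentRing

end GaussNorm

section ExpBounds

/-- `u` grows at most exponentially; the bounds `p^{lk}` of the paper have this form. Nothing is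
required of `u 0`. -/
def HasExpUpperBound (u : ℕ → ℝ) : Prop := ∃ C : ℝ, 1 ≤ C ∧ ∀ k, 0 < k → u k ≤ C ^ k

/-- `u` decays at most exponentially. Nothing is required of `u 0`. -/
def HasExpLowerBound (u : ℕ → ℝ) : Prop := ∃ C : ℝ, 1 ≤ C ∧ ∀ k, 0 < k → 1 ≤ C ^ k * u k

namespace HasExpUpperBound

variable {u v : ℕ → ℝ}

theorem const (c : ℝ) : HasExpUpperBound fun _ => c :=
  ⟨max 1 c, le_max_left _ _, fun _ hk =>
    (le_max_right 1 c).trans (le_self_pow₀ (le_max_left 1 c) hk.ne')⟩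

theorem mono (hv : HasExpUpperBound v) (h : ∀ k, u k ≤ v k) : HasExpUpperBound u :=
  let ⟨C, hC, hvC⟩ := hv
  ⟨C, hC, fun k hk => (h k).trans (hvC k hk)⟩

theorem add (hu : HasExpUpperBound u) (hv : HasExpUpperBound v) :
    HasExpUpperBound fun k => u k + v k := by
  obtain ⟨C, hC, huC⟩ := hu
  obtain ⟨D, hD, hvD⟩ := hv
  refine ⟨C + D, by linarith, fun k hk => (add_le_add (huC k hk) (hvD k hk)).trans ?_⟩
  exact pow_add_pow_le (by linarith) (by linarith) hk.ne'

theorem mul (hu : HasExpUpperBound u) (hv : HasExpUpperBound v) (hv₀ : ∀ k, 0 ≤ v k) :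
    HasExpUpperBound fun k => u k * v k := by
  obtain ⟨C, hC, huC⟩ := hu
  obtain ⟨D, hD, hvD⟩ := hv
  refine ⟨C * D, one_le_mul_of_one_le_of_one_le hC hD, fun k hk => ?_⟩
  rw [mul_pow]
  exact mul_le_mul (huC k hk) (hvD k hk) (hv₀ k) (by positivity)

theorem exists_uniform {ι : Type*} [Finite ι] {u : ι → ℕ → ℝ}
    (h : ∀ i, HasExpUpperBound (u i)) : ∃ C : ℝ, 1 ≤ C ∧ ∀ i k, 0 < k → u i k ≤ C ^ k := by
  choose C hC huC using h
  obtain ⟨D, hD⟩ := Finite.exists_le C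
  refine ⟨max 1 D, le_max_left _ _, fun i k hk => (huC i k hk).trans ?_⟩
  exact pow_le_pow_left₀ (zero_le_one.trans (hC i)) ((hD i).trans (le_max_right _ _)) k

end HasExpUpperBound

namespace HasExpLowerBound

variable {u v w : ℕ → ℝ}

theorem pos (hu : HasExpLowerBound u) {k : ℕ} (hk : 0 < k) : 0 < u k :=
  let ⟨_, hC, huC⟩ := hu
  pos_of_mul_pos_right (zero_lt_one.trans_le (huC k hk)) (pow_nonneg (zero_le_one.trans hC) k)

theorem const {c : ℝ} (hc : 0 < c) : HasExpLowerBound fun _ => c := by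
  refine ⟨max 1 c⁻¹, le_max_left _ _, fun k hk => ?_⟩
  rw [← inv_le_iff_one_le_mul₀ hc]
  exact (le_max_right 1 c⁻¹).trans (le_self_pow₀ (le_max_left 1 c⁻¹) hk.ne')

theorem mul (hu : HasExpLowerBound u) (hv : HasExpLowerBound v) :
    HasExpLowerBound fun k => u k * v k := by
  obtain ⟨C, hC, huC⟩ := hu
  obtain ⟨D, hD, hvD⟩ := hv
  refine ⟨C * D, one_le_mul_of_one_le_of_one_le hC hD, fun k hk => ?_⟩
  rw [mul_pow, mul_mul_mul_comm]
  exact one_le_mul_of_one_le_of_one_le (huC k hk) (hvD k hk)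

theorem pow (hu : HasExpLowerBound u) (e : ℕ) : HasExpLowerBound fun k => u k ^ e := by
  obtain ⟨C, hC, huC⟩ := hu
  refine ⟨C ^ e, one_le_pow₀ hC, fun k hk => ?_⟩
  rw [pow_right_comm, ← mul_pow]
  exact one_le_pow₀ (huC k hk)

theorem of_le_mul (hu : HasExpLowerBound u) (hw : HasExpUpperBound w) (hv : ∀ k, 0 ≤ v k)
    (h : ∀ k, 0 < k → u k ≤ w k * v k) : HasExpLowerBound v := by
  obtain ⟨C, hC, huC⟩ := hu
  obtain ⟨D, hD, hwD⟩ := hw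
  refine ⟨C * D, one_le_mul_of_one_le_of_one_le hC hD, fun k hk => ?_⟩
  calc 1 ≤ C ^ k * u k := huC k hk
    _ ≤ C ^ k * (D ^ k * v k) := by
      gcongr
      exact (h k hk).trans (mul_le_mul_of_nonneg_right (hwD k hk) (hv k))
    _ = (C * D) ^ k * v k := by rw [mul_pow, mul_assoc]

end HasExpLowerBound

end ExpBounds

section Determinants

variable {ι R : Type*} [Fintype ι] [DecidableEq ι] [CommRing R]

theorem det_mem_of_mem_matrix {H : Subring R} {M : Matrix ι ι R} (hM : M ∈ H.matrix) :
    M.det ∈ H := by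
  have hentry (i j : ι) : M i j ∈ H := hM i j
  rw [Matrix.det_apply]
  exact sum_mem fun s _ => zsmul_mem (prod_mem fun i _ => hentry (s i) i) _

theorem adjugate_mem_matrix {H : Subring R} {M : Matrix ι ι R} (hM : M ∈ H.matrix) :
    M.adjugate ∈ H.matrix := by
  intro i j
  rw [Matrix.adjugate_apply]
  refine det_mem_of_mem_matrix fun a b => ?_
  rw [Matrix.updateRow_apply]
  split_ifs
  · rw [Pi.single_apply]
    split_ifs
    exacts [one_mem H, zero_mem H]
  · exact hM a b

open Nat in
theorem exists_perm_forall_det_le [Nontrivial R] (v : AbsoluteValue R ℝ) (M : Matrix ι ι R) {C : ℝ}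
    (hM : ∀ i j, v (M i j) ≤ C) : ∃ s : Equiv.Perm ι, ∀ j,
      v M.det ≤ (Fintype.card ι)! * C ^ (Fintype.card ι - 1) * v (M (s j) j) := by
  obtain ⟨s, hs⟩ := Finite.exists_max fun s : Equiv.Perm ι => ∏ i, v (M (s i) i)
  refine ⟨s, fun j => ?_⟩
  have hdet : v M.det ≤ (Fintype.card ι)! * ∏ i, v (M (s i) i) := calc
    v M.det ≤ ∑ t : Equiv.Perm ι, v (t.sign • ∏ i, M (t i) i) := by
      rw [Matrix.det_apply]
      exact v.sum_le _ _
    _ = ∑ t : Equiv.Perm ι, ∏ i, v (M (t i) i) := by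
      simp only [v.map_units_int_smul, map_prod]
    _ ≤ ∑ _t : Equiv.Perm ι, ∏ i, v (M (s i) i) := Finset.sum_le_sum fun t _ => hs t
    _ = (Fintype.card ι)! * ∏ i, v (M (s i) i) := by
      rw [Finset.sum_const, Finset.card_univ, Fintype.card_perm, nsmul_eq_mul]
  have hprod : ∏ i, v (M (s i) i) ≤ C ^ (Fintype.card ι - 1) * v (M (s j) j) := by
    rw [← Finset.prod_erase_mul _ _ (Finset.mem_univ j)]
    gcongr
    refine (Finset.prod_le_prod (fun i _ => v.nonneg _) fun i _ => hM (s i) i).trans_eq ?_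
    rw [Finset.prod_const, Finset.card_erase_of_mem (Finset.mem_univ j), Finset.card_univ]
  rw [mul_assoc]
  exact hdet.trans (by gcongr)

theorem exists_perm_hasExpLowerBound [Nontrivial R] (v : AbsoluteValue R ℝ)
    {M : Matrix ι ι (ℕ → R)} (hM : ∀ i j, HasExpUpperBound fun k => v (M i j k))
    (hdet : HasExpLowerBound fun k => v (M.det k)) :
    ∃ s : ℕ → Equiv.Perm ι, ∀ j, HasExpLowerBound fun k => v (M (s k j) j k) := by
  obtain ⟨C, hC, hMC⟩ := HasExpUpperBound.exists_uniform fun x : ι × ι => hM x.1 x.2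
  have hperm : ∀ k, ∃ s : Equiv.Perm ι, ∀ j, 0 < k → v (M.det k) ≤
      (Fintype.card ι).factorial * (C ^ (Fintype.card ι - 1)) ^ k * v (M (s j) j k) := by
    intro k
    rcases k.eq_zero_or_pos with rfl | hk
    · exact ⟨1, fun _ h => absurd h (lt_irrefl 0)⟩
    obtain ⟨s, hs⟩ := exists_perm_forall_det_le v
      ((Pi.evalRingHom (fun _ : ℕ => R) k).mapMatrix M) fun i j => hMC (i, j) k hk
    refine ⟨s, fun j _ => ?_⟩
    rw [pow_right_comm, ← Pi.evalRingHom_apply (fun _ : ℕ => R) k M.det, RingHom.map_det]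
    exact hs j
  choose s hs using hperm
  have hw : HasExpUpperBound fun k =>
      ((Fintype.card ι).factorial : ℝ) * (C ^ (Fintype.card ι - 1)) ^ k :=
    (HasExpUpperBound.const _).mul ⟨_, one_le_pow₀ hC, fun _ _ => le_rfl⟩ fun k => by positivity
  exact ⟨s, fun j => hdet.of_le_mul hw (fun _ => v.nonneg _) fun k hk => hs k j hk⟩

end Determinants

section ExpGrowth

variable {K : Type u} [NontriviallyNormedField K] [CompleteSpace K] [IsUltrametricDist K] {n : ℕ}
  {𝓕 : Filter (Radius n)} [NeBot 𝓕] {σ : Radius n}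

variable (K 𝓕 σ) in
/-- The ring of sequences of Laurent series converging at `σ` whose Gauss norms at `σ` grow at most
exponentially. -/
def expGrowth : Subring (ℕ → LaurentRing K 𝓕) where
  carrier := {f | (∀ k, ConvergesAt (f k).1 σ) ∧ HasExpUpperBound fun k => (f k).gaussNorm σ}
  zero_mem' := ⟨fun _ => .zero σ, .const ((0 : LaurentRing K 𝓕).gaussNorm σ)⟩
  one_mem' := ⟨fun _ => .single 1 σ, .const ((1 : LaurentRing K 𝓕).gaussNorm σ)⟩
  add_mem' hf hg := ⟨fun k => (hf.1 k).add (hg.1 k),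
    (hf.2.add hg.2).mono fun k => LaurentRing.gaussNorm_add_le (hf.1 k) (hg.1 k)⟩
  mul_mem' hf hg := ⟨fun k => LaurentRing.convergesAt_mul (hf.1 k) (hg.1 k),
    (hf.2.mul hg.2 fun _ => LaurentRing.gaussNorm_nonneg _).mono fun k =>
      LaurentRing.gaussNorm_mul_le (hf.1 k) (hg.1 k)⟩
  neg_mem' hf := ⟨fun k => (hf.1 k).neg, hf.2.mono fun _ => (LaurentRing.gaussNorm_neg _).le⟩

theorem const_mem_expGrowth {f : LaurentRing K 𝓕} (hf : ConvergesAt f.1 σ) :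
    (fun _ => f) ∈ expGrowth K 𝓕 σ :=
  ⟨fun _ => hf, .const _⟩

theorem select_mem_expGrowth {ι : Type*} [Finite ι] {F : ι → ℕ → LaurentRing K 𝓕}
    (hF : ∀ i, F i ∈ expGrowth K 𝓕 σ) (s : ℕ → ι) :
    (fun k => F (s k) k) ∈ expGrowth K 𝓕 σ := by
  obtain ⟨C, hC, hFC⟩ := HasExpUpperBound.exists_uniform fun i => (hF i).2
  exact ⟨fun k => (hF (s k)).1 k, C, hC, fun k hk => hFC (s k) k hk⟩

end ExpGrowth

section Residue

variable {K : Type u} [NontriviallyNormedField K] [CompleteSpace K] [IsUltrametricDist K]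
  {n : ℕ} {𝓕 : Filter (Radius n)} [NeBot 𝓕] {N : ℕ}

/-- The part of a Laurent series whose exponents have `r`-th entry in the residue class `a`. -/
def residuePart (r : Fin n) (a : ZMod N) : LaurentRing K 𝓕 →ₗ[K] LaurentRing K 𝓕 :=
  LaurentRing.part {i | ((i r : ℤ) : ZMod N) = a}

theorem residuePart_apply (r : Fin n) (a : ZMod N) (f : LaurentRing K 𝓕) (i : Fin n → ℤ) :
    (residuePart r a f).1 i = if ((i r : ℤ) : ZMod N) = a then f.1 i else 0 := by
  by_cases h : ((i r : ℤ) : ZMod N) = a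
  · exact (if_pos h).trans (if_pos h).symm
  · exact (if_neg h).trans (if_neg h).symm

theorem ConvergesAt.residuePart {σ : Radius n} {f : LaurentRing K 𝓕} (hf : ConvergesAt f.1 σ)
    (r : Fin n) (a : ZMod N) : ConvergesAt (residuePart r a f).1 σ :=
  hf.of_le fun i => by
    rw [residuePart_apply]
    split_ifs <;> simp

theorem residuePart_residuePart_mul (r : Fin n) (a b : ZMod N) (f g : LaurentRing K 𝓕) :
    residuePart r a (residuePart r b f * g) = residuePart r b f * residuePart r (a - b) g := by
  refine LaurentRing.ext (funext fun i => ?_)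
  have hterm : ∀ j, (residuePart r b f).1 j * (residuePart r (a - b) g).1 (i - j) =
      if ((i r : ℤ) : ZMod N) = a then (residuePart r b f).1 j * g.1 (i - j) else 0 := by
    intro j
    simp only [residuePart_apply, Pi.sub_apply, Int.cast_sub]
    by_cases hj : ((j r : ℤ) : ZMod N) = b
    · simp [hj]
    · simp [hj]
  change _ = ∑' j, (residuePart r b f).1 j * (residuePart r (a - b) g).1 (i - j)
  rw [residuePart_apply, tsum_congr hterm]
  split_ifs
  · rfl
  · exact tsum_zero.symm

theorem residuePart_one (r : Fin n) (a : ZMod N) :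
    residuePart r a (1 : LaurentRing K 𝓕) = if a = 0 then 1 else 0 := by
  refine LaurentRing.ext (funext fun i => ?_)
  rcases eq_or_ne i 0 with rfl | hi
  · rw [residuePart_apply, Pi.zero_apply, Int.cast_zero]
    by_cases ha : a = 0
    · simp [ha]
    · rw [if_neg ha, if_neg (Ne.symm ha)]
      rfl
  · have hone : (1 : LaurentRing K 𝓕).1 i = 0 := Pi.single_eq_of_ne (M := fun _ => K) hi 1
    rw [residuePart_apply, hone, ite_self]
    split_ifs
    exacts [hone.symm, rfl]

variable [NeZero N]

theorem sum_residuePart (r : Fin n) (f : LaurentRing K 𝓕) :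
    ∑ a : ZMod N, residuePart r a f = f := by
  refine LaurentRing.ext (funext fun i => ?_)
  calc (∑ a : ZMod N, residuePart r a f).1 i
      = ∑ a : ZMod N, (residuePart r a f).1 i := map_sum (LaurentRing.coeff i) _ _
    _ = f.1 i := by simp only [residuePart_apply, Finset.sum_ite_eq, Finset.mem_univ, if_true]

theorem residuePart_mul (r : Fin n) (a : ZMod N) (f g : LaurentRing K 𝓕) :
    residuePart r a (f * g) = ∑ b : ZMod N, residuePart r b f * residuePart r (a - b) g := by
  conv_lhs => rw [← sum_residuePart (N := N) r f, Finset.sum_mul, map_sum]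
  exact Finset.sum_congr rfl fun b _ => residuePart_residuePart_mul r a b f g

end Residue

section HomogeneousRatio

variable {K : Type u} [NontriviallyNormedField K] [CompleteSpace K] [IsUltrametricDist K]
  {n : ℕ} {𝓕 : Filter (Radius n)} [NeBot 𝓕] {r : Fin n}

/-- `d / g` is homogeneous of degree `δ` for the `ℤ/N`-grading by `r`-th exponents, expressed
without denominators: multiplying the degree `a` part of `g` by `d` amounts to multiplying the
degree `a + δ` part of `d` by `g`. -/
def IsHomogeneousRatio (r : Fin n) {N : ℕ} (δ : ZMod N) (d g : LaurentRing K 𝓕) : Prop :=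
  ∀ a, d * residuePart r a g = residuePart r (a + δ) d * g

/- If the degree `b` part of `d` has the Gauss norm of `d`, multiplicativity of the Gauss norm shows
that the degree `b - δ` part of `g` has the Gauss norm of `g`. -/
theorem IsHomogeneousRatio.exists_dominant_terms {ρ : Radius n} (hρ : pure ρ ≤ 𝓕) {N : ℕ}
    {δ : ZMod N} {d g : LaurentRing K 𝓕} (h : IsHomogeneousRatio r δ d g) (hd : d ≠ 0)
    (hg : g ≠ 0) : ∃ i j : Fin n → ℤ, ‖d.1 i‖ * ρ.mono i = d.gaussNorm ρ ∧
      ‖g.1 j‖ * ρ.mono j = g.gaussNorm ρ ∧ δ = ((i r - j r : ℤ) : ZMod N) := by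
  have hd_pos := LaurentRing.gaussNorm_pos (d.convergesAt hρ) hd
  have hg_pos := LaurentRing.gaussNorm_pos (g.convergesAt hρ) hg
  obtain ⟨i, hi⟩ := LaurentRing.exists_eq_gaussNorm (d.convergesAt hρ)
  set b : ZMod N := ((i r : ℤ) : ZMod N)
  have hd_le : d.gaussNorm ρ ≤ (residuePart r b d).gaussNorm ρ := by
    have hpart := LaurentRing.le_gaussNorm ((d.convergesAt hρ).residuePart r b) i
    rwa [residuePart_apply, if_pos rfl, hi] at hpart
  have hg_le : g.gaussNorm ρ ≤ (residuePart r (b - δ) g).gaussNorm ρ := by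
    refine le_of_mul_le_mul_left ?_ hd_pos
    rw [← LaurentRing.gaussNorm_mul hρ, ← LaurentRing.gaussNorm_mul hρ, h, sub_add_cancel,
      LaurentRing.gaussNorm_mul hρ, LaurentRing.gaussNorm_mul hρ]
    exact mul_le_mul_of_nonneg_right hd_le hg_pos.le
  obtain ⟨j, hj⟩ :=
    LaurentRing.exists_eq_gaussNorm ((g.convergesAt hρ).residuePart r (b - δ))
  rw [residuePart_apply] at hj
  split_ifs at hj with hjr
  · refine ⟨i, j, hi, (LaurentRing.le_gaussNorm (g.convergesAt hρ) j).antisymm ?_, ?_⟩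
    · exact hg_le.trans_eq hj.symm
    · rw [Int.cast_sub, hjr, sub_sub_cancel]
  · rw [norm_zero, zero_mul] at hj
    exact absurd (hg_pos.trans_le hg_le) hj.not_lt

end HomogeneousRatio

section Scale

variable {n : ℕ}

/-- The multiradius `ρ` with its `r`-th entry multiplied by `exp t`. -/
def Radius.scale (ρ : Radius n) (r : Fin n) (t : ℝ) : Radius n := fun s =>
  ⟨ρ s * Real.exp (if s = r then t else 0), mul_pos (ρ s).2 (Real.exp_pos _)⟩

theorem Radius.scale_zero (ρ : Radius n) (r : Fin n) : ρ.scale r 0 = ρ := by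
  funext s
  simp [scale]

theorem Radius.continuous_scale (ρ : Radius n) (r : Fin n) : Continuous (ρ.scale r) := by
  refine continuous_pi fun s => Continuous.subtype_mk ?_ _
  split_ifs <;> fun_prop

theorem Radius.mono_scale (ρ : Radius n) (r : Fin n) (t : ℝ) (i : Fin n → ℤ) :
    (ρ.scale r t).mono i = ρ.mono i * Real.exp (t * i r) := by
  simp only [mono, scale, mul_zpow, Finset.prod_mul_distrib]
  congr 1
  rw [Finset.prod_eq_single r]
  · rw [if_pos rfl, Real.exp_mul, Real.rpow_intCast]
  · intro s _ hs
    rw [if_neg hs, Real.exp_zero, one_zpow]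
  · simp

theorem Radius.exists_scale_of_eventually {ρ : Radius n} {Q : Radius n → Prop}
    (hQ : ∀ᶠ σ in 𝓝 ρ, Q σ) :
    ∃ ε : ℝ, 0 < ε ∧ ∀ r, Q (ρ.scale r ε) ∧ Q (ρ.scale r (-ε)) := by
  have hscale : ∀ᶠ t : ℝ in 𝓝 0, ∀ r, Q (ρ.scale r t) := eventually_all.2 fun r => by
    have htendsto := (ρ.continuous_scale r).tendsto 0
    rw [ρ.scale_zero] at htendsto
    exact htendsto.eventually hQ
  obtain ⟨ε, hε, hball⟩ := Metric.eventually_nhds_iff.1 hscale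
  refine ⟨ε / 2, half_pos hε, fun r => ⟨hball ?_ r, hball ?_ r⟩⟩ <;>
    simp [abs_of_pos hε, hε]

variable {K : Type u} [NontriviallyNormedField K] [CompleteSpace K] [IsUltrametricDist K]
  {𝓕 : Filter (Radius n)} [NeBot 𝓕] {ρ : Radius n} {r : Fin n}

/- Scaling the radius multiplies a dominant term by `exp (t * i r)`, while it grows at most
exponentially in `k`. -/
theorem exists_mul_exponent_le {t : ℝ} {f : ℕ → LaurentRing K 𝓕}
    (hf : f ∈ expGrowth K 𝓕 (ρ.scale r t)) (hlow : HasExpLowerBound fun k => (f k).gaussNorm ρ) :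
    ∃ c : ℝ, ∀ k, 0 < k → ∀ i : Fin n → ℤ, ‖(f k).1 i‖ * ρ.mono i = (f k).gaussNorm ρ →
      t * i r ≤ c * k := by
  obtain ⟨D, hD, hfD⟩ := hf.2
  obtain ⟨G, hG, hfG⟩ := hlow
  refine ⟨Real.log (G * D), fun k hk i hi => ?_⟩
  have hterm : ‖(f k).1 i‖ * ρ.mono i * Real.exp (t * i r) ≤ D ^ k := by
    rw [mul_assoc, ← Radius.mono_scale]
    exact (LaurentRing.le_gaussNorm (hf.1 k) i).trans (hfD k hk)
  rw [mul_comm (Real.log _) (k : ℝ), ← Real.log_pow, Real.le_log_iff_exp_le (by positivity),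
    mul_pow]
  calc Real.exp (t * i r)
      ≤ G ^ k * (‖(f k).1 i‖ * ρ.mono i) * Real.exp (t * i r) :=
        le_mul_of_one_le_left (Real.exp_pos _).le ((hfG k hk).trans_eq (by rw [hi]))
    _ = G ^ k * (‖(f k).1 i‖ * ρ.mono i * Real.exp (t * i r)) := mul_assoc _ _ _
    _ ≤ G ^ k * D ^ k := by gcongr

theorem exists_abs_exponent_le {ε : ℝ} (hε : 0 < ε) {f : ℕ → LaurentRing K 𝓕}
    (hf : f ∈ expGrowth K 𝓕 (ρ.scale r ε) ⊓ expGrowth K 𝓕 (ρ.scale r (-ε)))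
    (hlow : HasExpLowerBound fun k => (f k).gaussNorm ρ) :
    ∃ c : ℝ, ∀ k, 0 < k → ∀ i : Fin n → ℤ, ‖(f k).1 i‖ * ρ.mono i = (f k).gaussNorm ρ →
      |(i r : ℝ)| ≤ c * k := by
  obtain ⟨c₁, hc₁⟩ := exists_mul_exponent_le hf.1 hlow
  obtain ⟨c₂, hc₂⟩ := exists_mul_exponent_le hf.2 hlow
  refine ⟨max c₁ c₂ / ε, fun k hk i hi => ?_⟩
  have hpos : ε * i r ≤ max c₁ c₂ * k :=
    (hc₁ k hk i hi).trans (by gcongr; exact le_max_left _ _)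
  have hneg : -ε * i r ≤ max c₁ c₂ * k :=
    (hc₂ k hk i hi).trans (by gcongr; exact le_max_right _ _)
  have habs : ε * |(i r : ℝ)| = |ε * i r| := by rw [abs_mul, abs_of_pos hε]
  rw [div_mul_eq_mul_div, le_div_iff₀' hε, habs]
  exact abs_le'.2 ⟨hpos, by rwa [← neg_mul]⟩

theorem exists_abs_degree_le (hρ : pure ρ ≤ 𝓕) {ε : ℝ} (hε : 0 < ε) {d g : ℕ → LaurentRing K 𝓕}
    (hd : d ∈ expGrowth K 𝓕 (ρ.scale r ε) ⊓ expGrowth K 𝓕 (ρ.scale r (-ε)))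
    (hg : g ∈ expGrowth K 𝓕 (ρ.scale r ε) ⊓ expGrowth K 𝓕 (ρ.scale r (-ε)))
    (hd_low : HasExpLowerBound fun k => (d k).gaussNorm ρ)
    (hg_low : HasExpLowerBound fun k => (g k).gaussNorm ρ) {N : ℕ → ℕ} {δ : ∀ k, ZMod (N k)}
    (h : ∀ k, 0 < k → IsHomogeneousRatio r (δ k) (d k) (g k)) :
    ∃ c : ℝ, ∀ k, 0 < k → ∃ t : ℤ, δ k = t ∧ |(t : ℝ)| ≤ c * k := by
  obtain ⟨c₁, hc₁⟩ := exists_abs_exponent_le hε hd hd_low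
  obtain ⟨c₂, hc₂⟩ := exists_abs_exponent_le hε hg hg_low
  have hne {f : ℕ → LaurentRing K 𝓕} (hf : HasExpLowerBound fun k => (f k).gaussNorm ρ) {k : ℕ}
      (hk : 0 < k) : f k ≠ 0 :=
    mt (LaurentRing.gaussNorm_eq_zero_iff ((f k).convergesAt hρ)).2 (hf.pos hk).ne'
  refine ⟨c₁ + c₂, fun k hk => ?_⟩
  obtain ⟨i, j, hi, hj, hδ⟩ := (h k hk).exists_dominant_terms hρ (hne hd_low hk) (hne hg_low hk)
  refine ⟨i r - j r, hδ, ?_⟩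
  rw [Int.cast_sub, add_mul]
  exact (abs_sub _ _).trans (add_le_add (hc₁ k hk i hi) (hc₂ k hk j hj))

end Scale

theorem pow_mul_angle_le {p : ℕ} [Fact p.Prime] {k : ℕ} {x : ℤ_[p]} {t : ℤ}
    (h : PadicInt.toZModPow k x = (t : ZMod (p ^ k))) :
    (p : ℝ) ^ k * angle ((x : ℚ_[p]) / (p : ℚ_[p]) ^ k) ≤ |(t : ℝ)| := by
  have hp_pos : (0 : ℝ) < (p : ℝ) ^ k := pow_pos (by exact_mod_cast (Fact.out : p.Prime).pos) _
  have hdiff : ‖(x : ℚ_[p]) - t‖ ≤ ((p : ℝ) ^ k)⁻¹ := by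
    have hmem : x - t ∈ RingHom.ker (PadicInt.toZModPow (p := p) k) := by
      rw [RingHom.mem_ker, map_sub, h, map_intCast, sub_self]
    rw [PadicInt.ker_toZModPow, ← PadicInt.norm_le_pow_iff_mem_span_pow, PadicInt.norm_def] at hmem
    simpa [zpow_neg] using hmem
  have hnorm : ‖(x : ℚ_[p]) / (p : ℚ_[p]) ^ k - (t : ℚ_[p]) / (p : ℚ_[p]) ^ k‖ ≤ 1 := by
    rw [← sub_div, norm_div, norm_pow, Padic.norm_p, inv_pow]
    exact div_le_one_of_le₀ hdiff (inv_nonneg.2 hp_pos.le)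
  rw [← le_div_iff₀' hp_pos]
  refine csInf_le ⟨0, fun a ha => ha.1⟩ ⟨by positivity, |t|, k, by push_cast; rfl, ?_⟩
  rcases abs_choice t with ht | ht
  · left
    rwa [ht]
  · right
    rwa [ht, Int.cast_neg, neg_div, ← sub_eq_add_neg]

section Fourier

theorem eq_zero_of_forall_sum_tmul_addChar_eq_zero {K V L : Type*} [Field K] [AddCommGroup V]
    [Module K V] [Field L] [Algebra K L] {N : ℕ} [NeZero N] {z : L} (hz : IsPrimitiveRoot z N)
    {F : ZMod N → V} (h : ∀ χ : AddChar (ZMod N) L, ∑ c, F c ⊗ₜ[K] χ c = (0 : V ⊗[K] L)) :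
    F = 0 := by
  let eval (c : ZMod N) : AddChar (ZMod N) L →* L :=
    { toFun := fun χ => χ c
      map_one' := AddChar.one_apply c
      map_mul' := fun χ ψ => AddChar.mul_apply χ ψ c }
  have heval : Function.Injective eval := fun a b hab => by
    have hz_pow := DFunLike.congr_fun hab (AddChar.zmodChar N hz.pow_eq_one)
    exact ZMod.val_injective N (hz.pow_inj (ZMod.val_lt a) (ZMod.val_lt b) hz_pow)
  have hli := (linearIndependent_monoidHom (AddChar (ZMod N) L) L).comp eval heval
  funext c
  refine (Module.forall_dual_apply_eq_zero_iff K _).1 fun φ => ?_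
  refine (map_eq_zero_iff _ (algebraMap K L).injective).1
    (Fintype.linearIndependent_iff.1 hli (fun c => algebraMap K L (φ (F c))) ?_ c)
  funext χ
  simpa [eval, Algebra.smul_def] using
    congrArg (fun x => TensorProduct.lid K L (LinearMap.rTensor L φ x)) (h χ)

variable {K : Type u} [NontriviallyNormedField K] [CompleteSpace K] [IsUltrametricDist K]
  {n : ℕ} {𝓕 : Filter (Radius n)} [NeBot 𝓕] {N : ℕ} [NeZero N] {L : Type*}

/-- The dilation `f(t) ↦ f(t_1, …, z t_r, …, t_n)` for the root of unity `z = χ 1`. -/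
def dilate [CommRing L] [Algebra K L] (r : Fin n) (χ : AddChar (ZMod N) L) :
    LaurentRing K 𝓕 →+* LaurentRing K 𝓕 ⊗[K] L where
  toFun f := ∑ a, residuePart r a f ⊗ₜ[K] χ a
  map_zero' := by simp
  map_add' f g := by simp [add_tmul, Finset.sum_add_distrib]
  map_one' := by
    simp_rw [residuePart_one, ite_tmul, Finset.sum_ite_eq', Finset.mem_univ, if_true,
      AddChar.map_zero_eq_one, Algebra.TensorProduct.one_def]
  map_mul' f g := by
    simp_rw [residuePart_mul, sum_tmul, Finset.sum_mul_sum, Algebra.TensorProduct.tmul_mul_tmul]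
    rw [Finset.sum_comm]
    refine Finset.sum_congr rfl fun b _ => ?_
    rw [← Equiv.sum_comp (Equiv.addLeft b)]
    simp only [Equiv.coe_addLeft, add_sub_cancel_left, AddChar.map_add_eq_mul]

theorem dilate_apply [CommRing L] [Algebra K L] (r : Fin n) (χ : AddChar (ZMod N) L)
    (f : LaurentRing K 𝓕) : dilate r χ f = ∑ a, residuePart r a f ⊗ₜ[K] χ a :=
  rfl

theorem isHomogeneousRatio_of_forall_dilate [Field L] [Algebra K L] {z : L}
    (hz : IsPrimitiveRoot z N) {r : Fin n} {α β : ZMod N} {d g : LaurentRing K 𝓕}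
    (h : ∀ χ : AddChar (ZMod N) L,
      (d ⊗ₜ[K] χ α) * dilate r χ g = dilate r χ d * (g ⊗ₜ[K] χ β)) :
    IsHomogeneousRatio r (α - β) d g := by
  have hzero := eq_zero_of_forall_sum_tmul_addChar_eq_zero (K := K) hz
    (F := fun c => d * residuePart r (c - α) g - residuePart r (c - β) d * g) fun χ => ?_
  · intro a
    have ha := congrFun hzero (a + α)
    rwa [Pi.zero_apply, add_sub_cancel_right, sub_eq_zero, add_sub_assoc] at ha
  have hχ := h χ
  simp_rw [dilate_apply, Finset.mul_sum, Finset.sum_mul, Algebra.TensorProduct.tmul_mul_tmul] at hχ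
  simp_rw [sub_tmul]
  rw [Finset.sum_sub_distrib, sub_eq_zero, ← Equiv.sum_comp (Equiv.addLeft α),
    ← Equiv.sum_comp (Equiv.addRight β) fun c => (residuePart r (c - β) d * g) ⊗ₜ[K] _]
  simpa only [Equiv.coe_addLeft, Equiv.coe_addRight, add_sub_cancel_left, add_sub_cancel_right,
    AddChar.map_add_eq_mul] using hχ

end Fourier

section Twist

theorem mulSingle_toHomUnits_pow {M ι : Type*} [CommMonoid M] [DecidableEq ι] {N : ℕ}
    (χ : AddChar (ZMod N) M) (r s : ι) :
    (Pi.mulSingle r (χ.toMonoidHom.toHomUnits (Multiplicative.ofAdd 1)) : ι → Mˣ) s ^ N = 1 := by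
  rw [← Pi.pow_apply, ← Pi.mulSingle_pow, ← map_pow, ← ofAdd_nsmul, nsmul_one,
    ZMod.natCast_self, ofAdd_zero, map_one, Pi.mulSingle_one, Pi.one_apply]

variable {K : Type u} [NontriviallyNormedField K] {p : ℕ} {n : ℕ}

/-- The element of `Γ_k^n` with `r`-th entry `χ 1` and all other entries `1`. -/
def GammaPow.single (r : Fin n) {k : ℕ} (χ : AddChar (ZMod (p ^ k)) (KGamma K p)) :
    GammaPow K p n :=
  ⟨Pi.mulSingle r (χ.toMonoidHom.toHomUnits (Multiplicative.ofAdd 1)), k,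
    mulSingle_toHomUnits_pow χ r⟩

namespace GammaPow

variable (r : Fin n) {k : ℕ} (χ : AddChar (ZMod (p ^ k)) (KGamma K p))

theorem single_inLevel : InLevel (single r χ) k :=
  mulSingle_toHomUnits_pow χ r

theorem single_apply_self : ((single r χ).1 r : KGamma K p) = χ 1 :=
  congrArg Units.val (Pi.mulSingle_eq_same (M := fun _ => (KGamma K p)ˣ) r _)

theorem single_apply_of_ne {s : Fin n} (h : s ≠ r) : (single r χ).1 s = 1 :=
  Pi.mulSingle_eq_of_ne (M := fun _ => (KGamma K p)ˣ) h _

theorem padicPow_single [Fact p.Prime] (a : Fin n → ℤ_[p]) :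
    padicPow (single r χ) k a = χ (PadicInt.toZModPow k (a r)) := by
  rw [padicPow, Fintype.prod_eq_single r fun s hs => by
      rw [single_apply_of_ne r χ hs, Units.val_one, one_pow],
    single_apply_self, ← AddChar.map_nsmul_eq_pow, nsmul_one, ZMod.natCast_zmod_val]

theorem prod_single_zpow (i : Fin n → ℤ) :
    ((∏ s, (single r χ).1 s ^ i s : (KGamma K p)ˣ) : KGamma K p) = χ (i r : ZMod (p ^ k)) := by
  rw [Fintype.prod_eq_single r fun s hs => by rw [single_apply_of_ne r χ hs, one_zpow],
    Units.val_zpow_eq_zpow_val, single_apply_self, ← AddChar.map_zsmul_eq_zpow, zsmul_one]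

end GammaPow

theorem exists_isPrimitiveRoot_kGamma [Fact p.Prime] (hp : (p : K) ≠ 0) (k : ℕ) :
    ∃ z : KGamma K p, IsPrimitiveRoot z (p ^ k) := by
  have hne : NeZero ((p ^ k : ℕ) : AlgebraicClosure K) := ⟨by
    rw [Nat.cast_pow, ← map_natCast (algebraMap K (AlgebraicClosure K)) p]
    exact pow_ne_zero k ((map_ne_zero _).2 hp)⟩
  obtain ⟨z, hz⟩ := HasEnoughRootsOfUnity.exists_primitiveRoot (AlgebraicClosure K) (p ^ k)
  have hmem : z ∈ KGamma K p := IntermediateField.subset_adjoin K _ ⟨k, hz.pow_eq_one⟩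
  exact ⟨⟨z, hmem⟩, IsPrimitiveRoot.of_map_of_injective (f := (KGamma K p).val) hz
    (KGamma K p).val.injective⟩

variable [CompleteSpace K] [IsUltrametricDist K] {𝓕 : Filter (Radius n)} [NeBot 𝓕]

namespace LaurentRingGamma

theorem coeff_tmul (i : Fin n → ℤ) (f : LaurentRing K 𝓕) (c : KGamma K p) :
    coeff i (f ⊗ₜ[K] c) = f.1 i • c :=
  rfl

theorem ext_coeff {x y : LaurentRingGamma 𝓕 K p} (h : ∀ i, coeff i x = coeff i y) : x = y := by
  let b := Module.Free.chooseBasis K (KGamma K p)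
  let φ := TensorProduct.equivFinsuppOfBasisRight (M := LaurentRing K 𝓕) b
  have hφ (x : LaurentRingGamma 𝓕 K p) (i j) : (φ x j).1 i = b.repr (coeff i x) j := by
    induction x using TensorProduct.induction_on with
    | zero =>
      simp only [map_zero, Finsupp.zero_apply]
      rfl
    | add x y hx hy =>
      simp only [map_add, Finsupp.add_apply, ← hx, ← hy]
      rfl
    | tmul f c =>
      rw [TensorProduct.equivFinsuppOfBasisRight_apply_tmul_apply, coeff_tmul, map_smul,
        Finsupp.smul_apply, smul_eq_mul, mul_comm]
      rfl
  refine φ.injective (Finsupp.ext fun j => LaurentRing.ext (funext fun i => ?_))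
  rw [hφ, hφ, h]

theorem twist_single [Fact p.Prime] (r : Fin n) {k : ℕ}
    (χ : AddChar (ZMod (p ^ k)) (KGamma K p)) (f : LaurentRing K 𝓕) :
    twist (GammaPow.single r χ) (f ⊗ₜ[K] 1) = dilate r χ f := by
  refine ext_coeff fun i => ?_
  rw [coeff_twist, GammaPow.prod_single_zpow, dilate_apply, map_sum]
  simp_rw [coeff_tmul, residuePart_apply, ite_smul, zero_smul, Finset.sum_ite_eq, Finset.mem_univ,
    if_true, mul_smul_comm, mul_one]

end LaurentRingGamma

end Twist

theorem adjugate_mul_intertwines {ι R Q : Type*} [Fintype ι] [DecidableEq ι] [CommRing R]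
    [CommRing Q] (φ τ : R →+* Q) {S T : Matrix ι ι R} {E D₁ D₂ : Matrix ι ι Q}
    (hS : E * S.map τ = S.map φ * D₁) (hT : E * T.map τ = T.map φ * D₂) :
    φ S.det • (D₁ * (S.adjugate * T).map τ) = τ S.det • ((S.adjugate * T).map φ * D₂) := by
  have hφ : S.adjugate.map φ * S.map φ = φ S.det • 1 := by
    rw [← Matrix.map_mul, Matrix.adjugate_mul, Matrix.map_smul' _ _ _ φ.map_mul,
      Matrix.map_one _ φ.map_zero φ.map_one]
  have hτ : S.map τ * S.adjugate.map τ = τ S.det • 1 := by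
    rw [← Matrix.map_mul, Matrix.mul_adjugate, Matrix.map_smul' _ _ _ τ.map_mul,
      Matrix.map_one _ τ.map_zero τ.map_one]
  calc φ S.det • (D₁ * (S.adjugate * T).map τ)
      = φ S.det • 1 * D₁ * S.adjugate.map τ * T.map τ := by
        rw [Matrix.map_mul, smul_mul_assoc, smul_mul_assoc, smul_mul_assoc, one_mul,
          Matrix.mul_assoc]
    _ = S.adjugate.map φ * E * (S.map τ * S.adjugate.map τ) * T.map τ := by
        rw [← hφ, Matrix.mul_assoc _ (S.map φ), ← hS]
        simp only [Matrix.mul_assoc]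
    _ = τ S.det • (S.adjugate.map φ * (E * T.map τ)) := by
        rw [hτ, mul_smul_comm, smul_mul_assoc, mul_one, Matrix.mul_assoc]
    _ = τ S.det • ((S.adjugate * T).map φ * D₂) := by
        rw [hT, Matrix.map_mul, Matrix.mul_assoc]

section Semilinear

variable {K : Type u} [NontriviallyNormedField K] [CompleteSpace K] [IsUltrametricDist K]
  {p : ℕ} {n : ℕ} {𝓕 : Filter (Radius n)} [NeBot 𝓕]

section ScalarAction

variable {P : Type v} [AddCommGroup P] [Module K P] [Module (LaurentRing K 𝓕) P]
  [IsScalarTower K (LaurentRing K 𝓕) P]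

theorem scalarAction_tmul (f : LaurentRing K 𝓕) (c d : KGamma K p) (x : P) :
    scalarAction K p 𝓕 P (f ⊗ₜ[K] c) (x ⊗ₜ[K] d) = (f • x) ⊗ₜ[K] (c * d) :=
  rfl

theorem rTensor_scalarAction (φ : P →ₗ[LaurentRing K 𝓕] LaurentRing K 𝓕)
    (c : LaurentRingGamma 𝓕 K p) (x : P ⊗[K] KGamma K p) :
    LinearMap.rTensor (KGamma K p) (φ.restrictScalars K) (scalarAction K p 𝓕 P c x) =
      c * LinearMap.rTensor (KGamma K p) (φ.restrictScalars K) x := by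
  induction c using TensorProduct.induction_on with
  | zero => simp
  | add a b ha hb => rw [map_add, LinearMap.add_apply, map_add, ha, hb, add_mul]
  | tmul f c =>
    induction x using TensorProduct.induction_on with
    | zero => simp
    | add a b ha hb => rw [map_add, map_add, map_add, ha, hb, mul_add]
    | tmul x d =>
      rw [scalarAction_tmul, LinearMap.rTensor_tmul, LinearMap.rTensor_tmul,
        Algebra.TensorProduct.tmul_mul_tmul, LinearMap.restrictScalars_apply,
        LinearMap.restrictScalars_apply, map_smul, smul_eq_mul]

end ScalarAction

namespace GammaModule

variable [Fact p.Prime]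

/-- `Γ_k^n` acts on `x` through the character `ζ ↦ ζ^a`. -/
def IsEigen (P : GammaModule.{u, v} K p 𝓕) (k : ℕ) (a : Fin n → ℤ_[p]) (x : P.carrier) : Prop :=
  ∀ ζ : GammaPow K p n, GammaPow.InLevel ζ k →
    P.act ζ (x ⊗ₜ[K] 1) = x ⊗ₜ[K] GammaPow.padicPow ζ k a

variable {P : GammaModule.{u, v} K p 𝓕} {k m : ℕ}
  {b : Module.Basis (Fin m) (LaurentRing K 𝓕) P.carrier}

theorem act_single_smul_tmul_one (r : Fin n) (χ : AddChar (ZMod (p ^ k)) (KGamma K p))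
    (f : LaurentRing K 𝓕) (x : P.carrier) :
    P.act (GammaPow.single r χ) ((f • x) ⊗ₜ[K] 1) =
      scalarAction K p 𝓕 P.carrier (dilate r χ f) (P.act (GammaPow.single r χ) (x ⊗ₜ[K] 1)) := by
  rw [← LaurentRingGamma.twist_single, ← P.semilinear, scalarAction_tmul, one_mul]

theorem reprMatrix_single_mul_map {S : Matrix (Fin m) (Fin m) (LaurentRing K 𝓕)}
    {A : Fin m → Fin n → ℤ_[p]} (hS : ∀ j, P.IsEigen k (A j) (∑ i, S i j • b i)) (r : Fin n)
    (χ : AddChar (ZMod (p ^ k)) (KGamma K p)) :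
    P.reprMatrix b (GammaPow.single r χ) * S.map (dilate r χ) =
      S.map Algebra.TensorProduct.includeLeftRingHom *
        Matrix.diagonal fun j => 1 ⊗ₜ[K] χ (PadicInt.toZModPow k (A j r)) := by
  ext i j
  have hcoord : b.coord i (∑ l, S l j • b l) = S i j := by simp [Finsupp.single_apply]
  have hij := congrArg (LinearMap.rTensor (KGamma K p) ((b.coord i).restrictScalars K))
    (hS j _ (GammaPow.single_inLevel r χ))
  rw [LinearMap.rTensor_tmul, LinearMap.restrictScalars_apply, hcoord, GammaPow.padicPow_single,
    sum_tmul, map_sum, map_sum] at hij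
  simp_rw [act_single_smul_tmul_one, rTensor_scalarAction] at hij
  rw [Matrix.mul_apply, Matrix.mul_diagonal, Matrix.map_apply,
    Algebra.TensorProduct.includeLeftRingHom_apply, Algebra.TensorProduct.tmul_mul_tmul, mul_one,
    one_mul, ← hij]
  exact Finset.sum_congr rfl fun l _ =>
    mul_comm (P.reprMatrix b (GammaPow.single r χ) i l) (dilate r χ (S l j))

theorem isHomogeneousRatio_det_adjugate_mul (hp : (p : K) ≠ 0)
    {S T : Matrix (Fin m) (Fin m) (LaurentRing K 𝓕)} {A B : Fin m → Fin n → ℤ_[p]}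
    (hS : ∀ j, P.IsEigen k (A j) (∑ i, S i j • b i))
    (hT : ∀ j, P.IsEigen k (B j) (∑ i, T i j • b i)) (r : Fin n) (i j : Fin m) :
    IsHomogeneousRatio r (PadicInt.toZModPow k (A i r - B j r)) S.det ((S.adjugate * T) i j) := by
  obtain ⟨z, hz⟩ := exists_isPrimitiveRoot_kGamma hp k
  rw [map_sub]
  refine isHomogeneousRatio_of_forall_dilate hz fun χ => ?_
  have hij := congrFun (congrFun (adjugate_mul_intertwines
    (Algebra.TensorProduct.includeLeftRingHom : _ →+* LaurentRingGamma 𝓕 K p) (dilate r χ)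
    (reprMatrix_single_mul_map hS r χ) (reprMatrix_single_mul_map hT r χ)) i) j
  rw [Matrix.smul_apply, Matrix.smul_apply, Matrix.diagonal_mul, Matrix.mul_diagonal,
    Matrix.map_apply, Matrix.map_apply, smul_eq_mul, smul_eq_mul, ← mul_assoc,
    Algebra.TensorProduct.includeLeftRingHom_apply, Algebra.TensorProduct.includeLeftRingHom_apply,
    Algebra.TensorProduct.tmul_mul_tmul, Algebra.TensorProduct.tmul_mul_tmul,
    mul_one, one_mul, mul_one, one_mul] at hij
  exact hij

end GammaModule

end Semilinear

section GermExponents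

variable {K : Type u} [NontriviallyNormedField K] [CompleteSpace K] [IsUltrametricDist K]
  {p n m : ℕ} {ρ : Radius n} {P : GammaModule.{u, v} K p (𝓝 ρ)}

namespace Model

variable {J : ClosedPolysegment ρ}

/-- The basis of `P` induced by a basis of a model of `P`. -/
def germBasis (P' : Model.{u, v, w} P J)
    (e : Module.Basis (Fin m) (PolyannulusRing K J) P'.toGammaModule.carrier) :
    Module.Basis (Fin m) (GermRing K ρ) P.carrier :=
  (e.baseChange (GermRing K ρ)).map P'.extend

theorem sum_smul_germBasis (P' : Model.{u, v, w} P J)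
    (e : Module.Basis (Fin m) (PolyannulusRing K J) P'.toGammaModule.carrier)
    (s : Fin m → PolyannulusRing K J) :
    ∑ i, LaurentRing.restrict (K := K) J.nhds_le (s i) • P'.germBasis e i =
      P'.extend (1 ⊗ₜ[PolyannulusRing K J] ∑ i, s i • e i) := by
  rw [tmul_sum, map_sum]
  refine Finset.sum_congr rfl fun i _ => ?_
  rw [germBasis, Module.Basis.map_apply, Module.Basis.baseChange_apply, ← map_smul, tmul_smul]
  exact congrArg _ (algebraMap_smul (GermRing K ρ) (s i) _)

end Model

variable [Fact p.Prime]

namespace GammaModule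

/-- The notion of exponent transported to the germ ring `R_ρ`: the matrices `S_k`, bundled as one
matrix `S` of sequences, are taken over `R_ρ`, the bound on `|S_k|` is required at each radius near
`ρ` separately, and `|det S_k|` is bounded below at `ρ` only, by an exponential in `-k`. With these
relaxations the notion does not depend on the basis. -/
def IsGermExponent (P : GammaModule.{u, v} K p (𝓝 ρ))
    (b : Module.Basis (Fin m) (GermRing K ρ) P.carrier) (A : Fin m → Fin n → ℤ_[p]) : Prop :=
  ∃ S : Matrix (Fin m) (Fin m) (ℕ → GermRing K ρ),
    (∀ k, 0 < k → ∀ j, P.IsEigen k (A j) (∑ i, S i j k • b i)) ∧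
    (∀ᶠ σ in 𝓝 ρ, S ∈ (expGrowth K (𝓝 ρ) σ).matrix) ∧
    HasExpLowerBound fun k => (S.det k).gaussNorm ρ

variable {A B : Fin m → Fin n → ℤ_[p]}
  {b b' : Module.Basis (Fin m) (GermRing K ρ) P.carrier}

theorem IsGermExponent.of_basis (hA : P.IsGermExponent b' A) : P.IsGermExponent b A := by
  obtain ⟨S, hEigen, hGrowth, hDet⟩ := hA
  let U : Matrix (Fin m) (Fin m) (ℕ → GermRing K ρ) := (b.toMatrix b').map (Pi.constRingHom ℕ _)
  have hUdet : U.det = fun _ => (b.toMatrix b').det :=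
    ((Pi.constRingHom ℕ (GermRing K ρ)).map_det _).symm
  have hdet_ne : (b.toMatrix b').det ≠ 0 := left_ne_zero_of_mul_eq_one <| by
    rw [← Matrix.det_mul, b.toMatrix_mul_toMatrix_flip b', Matrix.det_one]
  refine ⟨U * S, fun k hk j => ?_, ?_, ?_⟩
  · convert hEigen k hk j using 1
    simp_rw [Matrix.mul_apply, Finset.sum_apply, Pi.mul_apply, Finset.sum_smul]
    rw [Finset.sum_comm]
    refine Finset.sum_congr rfl fun l _ => ?_
    rw [← b.sum_toMatrix_smul_self b' l, Finset.smul_sum]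
    exact Finset.sum_congr rfl fun i _ => by rw [smul_smul, mul_comm]; rfl
  · have hU : ∀ᶠ σ in 𝓝 ρ, ∀ i j, ConvergesAt (b.toMatrix b' i j).1 σ :=
      eventually_all.2 fun i => eventually_all.2 fun j => (b.toMatrix b' i j).2
    filter_upwards [hU, hGrowth] with σ hUσ hSσ
    exact mul_mem (fun i j => const_mem_expGrowth (hUσ i j)) hSσ
  · have hUpos : 0 < (b.toMatrix b').det.gaussNorm ρ :=
      (LaurentRing.gaussAbv (pure_le_nhds ρ)).pos hdet_ne
    simpa only [Matrix.det_mul, hUdet, Pi.mul_apply, LaurentRing.gaussNorm_mul (pure_le_nhds ρ)]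
      using (HasExpLowerBound.const hUpos).mul hDet

theorem isHomogeneousRatio_det_adjugate_mul_apply (hp : (p : K) ≠ 0)
    {S T : Matrix (Fin m) (Fin m) (ℕ → GermRing K ρ)} {k : ℕ}
    (hS : ∀ j, P.IsEigen k (A j) (∑ i, S i j k • b i))
    (hT : ∀ j, P.IsEigen k (B j) (∑ i, T i j k • b i)) (r : Fin n) (i j : Fin m) :
    IsHomogeneousRatio r (PadicInt.toZModPow k (A i r - B j r)) (S.det k)
      ((S.adjugate * T) i j k) := by
  let eval := Pi.evalRingHom (fun _ : ℕ => GermRing K ρ) k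
  have hratio := isHomogeneousRatio_det_adjugate_mul hp (S := eval.mapMatrix S)
    (T := eval.mapMatrix T) hS hT r i j
  rwa [← RingHom.map_det, ← RingHom.map_adjugate, ← map_mul] at hratio

theorem IsGermExponent.weaklyEquivalent (hp : (p : K) ≠ 0) (hA : P.IsGermExponent b A)
    (hB : P.IsGermExponent b B) : WeaklyEquivalent A B := by
  obtain ⟨S, hSeigen, hSgrowth, hSdet⟩ := hA
  obtain ⟨T, hTeigen, hTgrowth, hTdet⟩ := hB
  set N := S.adjugate * T with hNdef
  have hNgrowth : ∀ᶠ σ in 𝓝 ρ, N ∈ (expGrowth K (𝓝 ρ) σ).matrix := by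
    filter_upwards [hSgrowth, hTgrowth] with σ hSσ hTσ
    exact mul_mem (adjugate_mem_matrix hSσ) hTσ
  have hNdet : HasExpLowerBound fun k => LaurentRing.gaussAbv (pure_le_nhds ρ) (N.det k) := by
    simp_rw [hNdef, Matrix.det_mul, Matrix.det_adjugate, Pi.mul_apply, Pi.pow_apply, map_mul,
      map_pow]
    exact (hSdet.pow _).mul hTdet
  obtain ⟨s, hs⟩ := exists_perm_hasExpLowerBound (LaurentRing.gaussAbv (pure_le_nhds ρ))
    (fun i j => (hNgrowth.self_of_nhds i j).2) hNdet
  obtain ⟨ε, hε, hscale⟩ := Radius.exists_scale_of_eventually (hSgrowth.and hNgrowth)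
  have hbound : ∀ x : Fin n × Fin m, ∃ c : ℝ, ∀ k, 0 < k → (p : ℝ) ^ k *
      angle (((A (s k x.2) x.1 - B x.2 x.1 : ℤ_[p]) : ℚ_[p]) / (p : ℚ_[p]) ^ k) ≤ c * k := by
    rintro ⟨r, j⟩
    obtain ⟨⟨hS₁, hN₁⟩, hS₂, hN₂⟩ := hscale r
    obtain ⟨c, hc⟩ := exists_abs_degree_le (pure_le_nhds ρ) hε
      ⟨det_mem_of_mem_matrix hS₁, det_mem_of_mem_matrix hS₂⟩
      ⟨select_mem_expGrowth (fun i => hN₁ i j) fun k => s k j,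
        select_mem_expGrowth (fun i => hN₂ i j) fun k => s k j⟩ hSdet (hs j)
      fun k hk => isHomogeneousRatio_det_adjugate_mul_apply hp (hSeigen k hk) (hTeigen k hk) r _ j
    refine ⟨c, fun k hk => ?_⟩
    obtain ⟨t, ht, htc⟩ := hc k hk
    exact (pow_mul_angle_le ht).trans htc
  choose c hc using hbound
  obtain ⟨C, hC⟩ := Finite.exists_le c
  refine ⟨max C 1, lt_max_of_lt_right one_pos, s, fun k hk r j => (hc (r, j) k hk).trans ?_⟩
  exact mul_le_mul_of_nonneg_right ((hC _).trans (le_max_left _ _)) k.cast_nonneg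

end GammaModule

namespace Model

variable {J : ClosedPolysegment ρ}

theorem isEigen_extend (P' : Model.{u, v, w} P J) {k : ℕ} {a : Fin n → ℤ_[p]}
    {x : P'.toGammaModule.carrier} (hx : P'.toGammaModule.IsEigen k a x) :
    P.IsEigen k a (P'.extend (1 ⊗ₜ[PolyannulusRing K J] x)) := fun ζ hζ => by
  have hact := P'.act_extend ζ (x ⊗ₜ[K] 1)
  rw [hx ζ hζ] at hact
  exact hact.symm

theorem IsExponent.exists_isGermExponent {P' : Model.{u, v, w} P J} {A : Fin m → Fin n → ℤ_[p]}
    (hA : P'.IsExponent A) : ∃ b, P.IsGermExponent b A := by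
  obtain ⟨e, S, hEigen, ⟨l, hl, hGrowth⟩, hDet⟩ := hA
  have hp : (1 : ℝ) ≤ p := by exact_mod_cast (Fact.out : p.Prime).one_le
  let germ := (LaurentRing.restrict (K := K) J.nhds_le).toRingHom
  refine ⟨P'.germBasis e, Matrix.of fun i j k => germ (S k i j), fun k hk j => ?_, ?_, ?_⟩
  · have := P'.isEigen_extend fun ζ hζ => hEigen k hk ζ hζ j
    rwa [← sum_smul_germBasis] at this
  · filter_upwards [J.mem_nhds] with σ hσ i j
    refine ⟨fun k => eventually_principal.1 (S k i j).2 σ hσ, (p : ℝ) ^ l,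
      Real.one_le_rpow hp hl.le, fun k hk => ?_⟩
    rw [← Real.rpow_natCast, ← Real.rpow_mul (zero_le_one.trans hp)]
    exact hGrowth k hk i j σ hσ
  · refine ⟨1, le_rfl, fun k hk => ?_⟩
    have hdet : (Matrix.of fun i j k => germ (S k i j)).det k = germ (S k).det :=
      ((Pi.evalRingHom (fun _ : ℕ => GermRing K ρ) k).map_det _).trans (germ.map_det _).symm
    calc 1 ≤ (germ (S k).det).gaussNorm ρ := hDet k hk ρ (mem_of_mem_nhds J.mem_nhds)
      _ = _ := by rw [one_pow, one_mul, ← hdet]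

end Model

end GermExponents

end PFuchs

end

theorem mainTheorem7_general {K : Type u} [NontriviallyNormedField K] [CompleteSpace K]
    [IsUltrametricDist K] {p : ℕ} [Fact p.Prime] (hp : (p : K) ≠ 0) {n : ℕ} {ρ : PFuchs.Radius n}
    {P : PFuchs.GammaModule.{u, v} K p (nhds ρ)} {J₁ J₂ : PFuchs.ClosedPolysegment ρ}
    {P₁ : PFuchs.Model.{u, v, w₁} P J₁} {P₂ : PFuchs.Model.{u, v, w₂} P J₂} {m : ℕ}
    {A B : Fin m → Fin n → ℤ_[p]} (hA : P₁.IsExponent A) (hB : P₂.IsExponent B) :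
    PFuchs.WeaklyEquivalent A B := by
  obtain ⟨b₁, hA⟩ := hA.exists_isGermExponent
  obtain ⟨b₂, hB⟩ := hB.exists_isGermExponent
  exact hA.weaklyEquivalent hp hB.of_basis

theorem mainTheorem7 {K : Type u} [NontriviallyNormedField K] [CompleteSpace K]
    [IsUltrametricDist K] [CharZero K] (p : ℕ) [Fact p.Prime] (hp : ‖(p : K)‖ = (p : ℝ)⁻¹)
    {n : ℕ} (hn : 0 < n) (ρ : PFuchs.Radius n) (P : PFuchs.CObj.{u, v} K p ρ) :
    (∀ (J₁ J₂ : PFuchs.ClosedPolysegment ρ)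
      (P₁ : PFuchs.Model.{u, v, w₁} P.toGammaModule J₁)
      (P₂ : PFuchs.Model.{u, v, w₂} P.toGammaModule J₂)
      (m : ℕ) (A B : Fin m → Fin n → ℤ_[p]),
      P₁.IsExponent A → P₂.IsExponent B → PFuchs.WeaklyEquivalent A B) ∧
    (∀ (m : ℕ) (A B : Fin m → Fin n → ℤ_[p]),
      P.IsExponent A → P.IsExponent B → PFuchs.WeaklyEquivalent A B) := by
  have hp₀ : (p : K) ≠ 0 := Nat.cast_ne_zero.2 (Fact.out : p.Prime).ne_zero
  exact ⟨fun _ _ _ _ _ _ _ hA hB => mainTheorem7_general hp₀ hA hB,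
    fun _ _ _ ⟨_, _, hA⟩ ⟨_, _, hB⟩ => mainTheorem7_general hp₀ hA hB⟩
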